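/- A *field* on the sphere $S^2\subset\mathbb R^3$ is a jointly measurable map $T:S^2\times\Omega\to\mathbb R$ on a probability space $(\Omega,\mathcal F,P)$ with $E\,T(x)=0$ and $E\,T(x)^2<\infty$ for every $x\in S^2$. It is *strongly isotropic* if $(T(x_1),\dots,T(x_k))$ and $(T(gx_1),\dots,T(gx_k))$ have the same law for all $k$, all $x_1,\dots,x_k\in S^2$ and all $g\in SO(3)$. It is *$n$-weakly isotropic* if $E|T(x)|^n<\infty$ for all $x$ and $E[T(x_1)\cdots T(x_n)]=E[T(gx_1)\cdots T(gx_n)]$ for all $x_1,\dots,x_n\in S^2$ and $g\in SO(3)$. Let $dx$ be the surface measure on $S^2$, let $Y_{lm}$ ($l\ge 0$, $-l\le m\le l$) be the orthonormal complex spherical harmonics, and put $a_{lm}=\int_{S^2}T(x)\overline{Y_{lm}(x)}\,dx$ and $a_{l\cdot}=(a_{l,-l},\dots,a_{l,l})$. Let $D^l(g)$ be Wigner's $(2l+1)\times(2l+1)$ matrix, i.e. the matrix in the basis $(Y_{lm})_m$ of $f\mapsto f(g^{-1}\,\cdot)$. For $l_1,\dots,l_n\ge 0$ let $$\Delta_{l_1\dots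 l_n}(g)=D^{l_1}(g)\otimes\cdots\otimes D^{l_n}(g),\qquad \Delta_{l_1\dots l_n}=\int_{SO(3)}\Delta_{l_1\dots l_n}(g)\,dg,\qquad S_{l_1\dots l_n}=E[a_{l_1\cdot}\otimes\cdots\otimes a_{l_n\cdot}],$$ where $\otimes$ is the Kronecker product and $dg$ is the Haar probability measure on $SO(3)$. Let $n\ge 2$ and let $T$ be a field on $S^2$. (1) Suppose that $T$ is strongly isotropic and $E|T(x)|^n<\infty$ for all $x$. Then $E|a_{lm}|^n<\infty$ for all $l,m$, and for all $l_1,\dots,l_n\ge 0$ and all $g^*\in SO(3)$ $$\Delta_{l_1\dots l_n}S_{l_1\dots l_n}=S_{l_1\dots l_n}\qquad\text{and}\qquad \Delta_{l_1\dots l_n}(g^*)\,S_{l_1\dots l_n}=S_{l_1\dots l_n}.$$ (2) Suppose, without assuming isotropy, that $\sup_{x}E|T(x)|^n<\infty$. Then $x\mapsto T(x)$ is $P$-almost surely square integrable with respect to $dx$, and $E|a_{lm}|^n<\infty$ for all $l,m$. If moreover $\Delta_{l_1\dots l_n}S_{l_1\dots l_n}=S_{l_1\dots l_n}$ for all $0\le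 l_1\le\cdots\le l_n$, then for all $l_1,\dots,l_n\ge 0$ and all $g\in SO(3)$ $$E\big[D^{l_1}(g)a_{l_1\cdot}\otimes\cdots\otimes D^{l_n}(g)a_{l_n\cdot}\big]=E\big[a_{l_1\cdot}\otimes\cdots\otimes a_{l_n\cdot}\big];$$ for every $g\in SO(3)$ the equality $E[T(x_1)\cdots T(x_n)]=E[T(gx_1)\cdots T(gx_n)]$ holds for almost every $(x_1,\dots,x_n)\in (S^2)^n$ with respect to the product surface measure; and if $T$ is continuous in probability at every point of $S^2$ (for instance, if its trajectories are almost surely continuous), then $T$ is $n$-weakly isotropic. -/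

import Mathlib

open MeasureTheory ProbabilityTheory Topology
open scoped ComplexConjugate

namespace Polyspectra

/-! ### The sphere, the rotation group and its Haar measure -/

/-- The unit sphere of `ℝ³`. -/
abbrev S2 : Type := Metric.sphere (0 : EuclideanSpace ℝ (Fin 3)) 1

/-- The rotation group `SO(3)`. -/
abbrev SO3 : Type := Matrix.specialOrthogonalGroup (Fin 3) ℝ

/-- The surface (Lebesgue) measure `dx` on the sphere, of total mass `4π`. -/
noncomputable def surf : Measure S2 :=
  (volume : Measure (EuclideanSpace ℝ (Fin 3))).toSphere

theorem norm_rotate (g : SO3) (x : EuclideanSpace ℝ (Fin 3)) :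
    ‖WithLp.toLp 2 (g.1.mulVec x.ofLp)‖ = ‖x‖ := by
  have hg : (g.1).transpose * g.1 = 1 := by
    have h := (Matrix.mem_orthogonalGroup_iff' (Fin 3) ℝ).1
      ((Matrix.mem_specialOrthogonalGroup_iff).1 g.2).1
    simpa [Matrix.star_eq_conjTranspose] using h
  have h2 : ‖WithLp.toLp 2 (g.1.mulVec x.ofLp)‖ ^ 2 = ‖x‖ ^ 2 := by
    rw [EuclideanSpace.real_norm_sq_eq, EuclideanSpace.real_norm_sq_eq]
    have : (g.1.mulVec x.ofLp) ⬝ᵥ (g.1.mulVec x.ofLp) = x.ofLp ⬝ᵥ x.ofLp := by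
      rw [Matrix.dotProduct_mulVec, ← Matrix.mulVec_transpose, Matrix.mulVec_mulVec, hg,
        Matrix.one_mulVec]
    simpa [dotProduct, sq] using this
  exact (sq_eq_sq₀ (norm_nonneg _) (norm_nonneg _)).1 h2

/-- The action `x ↦ g x` of a rotation on the sphere. -/
noncomputable def rotate (g : SO3) (x : S2) : S2 :=
  ⟨WithLp.toLp 2 (g.1.mulVec x.1.ofLp), by
    rw [mem_sphere_zero_iff_norm, norm_rotate]
    exact mem_sphere_zero_iff_norm.1 x.2⟩

instance : IsTopologicalGroup SO3 where
  continuous_mul := continuous_mul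
  continuous_inv := by
    refine Continuous.subtype_mk (f := fun g : SO3 => star g.1) ?_ _
    exact continuous_subtype_val.star

instance : CompactSpace SO3 := by
  refine isCompact_iff_compactSpace (s := (Matrix.specialOrthogonalGroup (Fin 3) ℝ :
    Set (Matrix (Fin 3) (Fin 3) ℝ))).1 ?_
  have hK : IsCompact (Set.pi Set.univ fun _ : Fin 3 =>
      Set.pi Set.univ fun _ : Fin 3 => Set.Icc (-1 : ℝ) 1) :=
    isCompact_univ_pi fun _ => isCompact_univ_pi fun _ => isCompact_Icc
  refine IsCompact.of_isClosed_subset hK ?_ ?_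
  · have h1 : IsClosed {A : Matrix (Fin 3) (Fin 3) ℝ | A * A.transpose = 1} :=
      isClosed_eq (by fun_prop) continuous_const
    have h2 : IsClosed {A : Matrix (Fin 3) (Fin 3) ℝ | A.det = 1} :=
      isClosed_eq (by fun_prop) continuous_const
    convert h1.inter h2 using 1
    ext A
    simp [Matrix.mem_specialOrthogonalGroup_iff, Matrix.mem_orthogonalGroup_iff]
  · intro A hA i _ j _
    have h := entry_norm_bound_of_unitary
      ((Matrix.mem_specialOrthogonalGroup_iff).1 hA).1 i j
    exact abs_le.1 h

instance : MeasurableSpace SO3 := borel SO3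

instance : BorelSpace SO3 := ⟨rfl⟩

/-- The Haar probability measure `dg` on `SO(3)`. -/
noncomputable def haarSO3 : Measure SO3 := Measure.haarMeasure ⊤

/-! ### Spherical harmonics and Wigner matrices -/

/-- The Legendre polynomial `P_l`, by Rodrigues' formula. -/
noncomputable def legendre (l : ℕ) : Polynomial ℝ :=
  Polynomial.C (1 / (2 ^ l * (l.factorial : ℝ))) *
    Polynomial.derivative^[l] ((Polynomial.X ^ 2 - 1) ^ l)

/-- The associated Legendre function
`P_{lm}(t) = (-1)^m (1 - t²)^{m/2} (d/dt)^m P_l(t)`. -/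
noncomputable def assocLegendre (l m : ℕ) (t : ℝ) : ℝ :=
  (-1) ^ m * Real.sqrt (1 - t ^ 2) ^ m * (Polynomial.derivative^[m] (legendre l)).eval t

/-- `Y_{lm}` for `0 ≤ m ≤ l`. For the point with spherical coordinates `(θ, φ)`, the third
Cartesian coordinate is `cos θ`, and `φ` is the argument of `x₀ + i x₁`; at the poles the value of
`φ` does not matter. -/
noncomputable def sphHarmNat (l m : ℕ) (x : S2) : ℂ :=
  ((Real.sqrt ((2 * l + 1) / (4 * Real.pi) * ((l - m).factorial / (l + m).factorial)) *
      assocLegendre l m (x.1 2) : ℝ) : ℂ) *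
    Complex.exp (Complex.I * m * Complex.arg (⟨x.1 0, x.1 1⟩ : ℂ))

/-- The spherical harmonic `Y_{lm}`, `-l ≤ m ≤ l`. -/
noncomputable def sphHarm (l : ℕ) (m : ℤ) (x : S2) : ℂ :=
  if 0 ≤ m then sphHarmNat l m.toNat x
  else (-1) ^ m.natAbs * conj (sphHarmNat l m.natAbs x)

/-- The index set `{-l, …, l}`. -/
abbrev MIdx (l : ℕ) : Type := Finset.Icc (-(l : ℤ)) (l : ℤ)

/-- Wigner's matrix `D^l(g)`: the matrix, in the orthonormal basis `Y_{l,-l}, …, Y_{l,l}`, of the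
representation `(g f)(x) = f (g⁻¹ x)` of `SO(3)` on the spherical harmonics of degree `l`, that is,
`Y_{lm'}(g⁻¹ x) = ∑_m D^l_{m m'}(g) Y_{lm}(x)`. -/
noncomputable def wignerD (l : ℕ) (g : SO3) : Matrix (MIdx l) (MIdx l) ℂ :=
  Matrix.of fun m m' => ∫ x, conj (sphHarm l m x) * sphHarm l m' (rotate g⁻¹ x) ∂surf

/-! ### Kronecker products and the matrices `Δ` -/

/-- The index set of `(2l₁+1)⋯(2lₙ+1)`-dimensional Kronecker products. -/
abbrev KIdx {n : ℕ} (l : Fin n → ℕ) : Type := (i : Fin n) → MIdx (l i)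

/-- The Kronecker product `v₁ ⊗ ⋯ ⊗ vₙ` of vectors. -/
noncomputable def kronVec {n : ℕ} (l : Fin n → ℕ) (v : (i : Fin n) → MIdx (l i) → ℂ) :
    KIdx l → ℂ :=
  fun m => ∏ i, v i (m i)

/-- `Δ_{l₁…lₙ}(g) = D^{l₁}(g) ⊗ ⋯ ⊗ D^{lₙ}(g)`. -/
noncomputable def DeltaAt {n : ℕ} (l : Fin n → ℕ) (g : SO3) : Matrix (KIdx l) (KIdx l) ℂ :=
  Matrix.of fun m m' => ∏ i, wignerD (l i) g (m i) (m' i)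

/-- `Δ_{l₁…lₙ} = ∫ D^{l₁}(g) ⊗ ⋯ ⊗ D^{lₙ}(g) dg`, entry by entry. -/
noncomputable def Delta {n : ℕ} (l : Fin n → ℕ) : Matrix (KIdx l) (KIdx l) ℂ :=
  Matrix.of fun m m' => ∫ g, DeltaAt l g m m' ∂haarSO3

/-! ### Random fields on the sphere -/

section Field

variable {Ω : Type*} [MeasurableSpace Ω]

/-- A random field on the sphere: real-valued, jointly measurable, centered, square integrable. -/
structure IsRandomField (P : Measure Ω) (T : S2 → Ω → ℝ) : Prop where
  measurable : Measurable (Function.uncurry T)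
  sq_integrable : ∀ x, MemLp (T x) 2 P
  centered : ∀ x, ∫ ω, T x ω ∂P = 0

/-- Strong isotropy: the finite-dimensional laws are invariant under rotations. -/
def StronglyIsotropic (P : Measure Ω) (T : S2 → Ω → ℝ) : Prop :=
  ∀ (k : ℕ) (x : Fin k → S2) (g : SO3),
    IdentDistrib (fun ω i => T (x i) ω) (fun ω i => T (rotate g (x i)) ω) P P

/-- `n`-weak isotropy: finite moments of order `n`, and rotation invariant `n`-point moments. -/
def WeaklyIsotropic (P : Measure Ω) (T : S2 → Ω → ℝ) (n : ℕ) : Prop :=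
  (∀ x, MemLp (T x) n P) ∧
    ∀ (x : Fin n → S2) (g : SO3),
      ∫ ω, ∏ i, T (x i) ω ∂P = ∫ ω, ∏ i, T (rotate g (x i)) ω ∂P

/-- `sup_x E|T(x)|^n`, in `[0, ∞]`. -/
noncomputable def supMoment (P : Measure Ω) (T : S2 → Ω → ℝ) (n : ℕ) : ENNReal :=
  ⨆ x, ∫⁻ ω, ‖T x ω‖ₑ ^ n ∂P

/-- Continuity in probability at every point of the sphere. -/
def StochContinuous (P : Measure Ω) (T : S2 → Ω → ℝ) : Prop :=
  ∀ x₀ : S2, TendstoInMeasure P T (𝓝 x₀) (T x₀)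

/-- The random harmonic coefficients `a_{lm} = ∫ T(x) conj(Y_{lm}(x)) dx`, as a vector `a_{l·}`. -/
noncomputable def coeff (T : S2 → Ω → ℝ) (l : ℕ) (ω : Ω) : MIdx l → ℂ :=
  fun m => ∫ x, (T x ω : ℂ) * conj (sphHarm l m x) ∂surf

/-- Finite spectral moments of order `n`: `E|a_{lm}|^n < ∞` for all `l`, `m`. -/
def FiniteSpectralMoments (P : Measure Ω) (T : S2 → Ω → ℝ) (n : ℕ) : Prop :=
  ∀ (l : ℕ) (m : MIdx l), MemLp (fun ω => coeff T l ω m) n P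

/-- The polyspectrum `S_{l₁…lₙ} = E[a_{l₁·} ⊗ ⋯ ⊗ a_{lₙ·}]`, entry by entry. -/
noncomputable def polyspectrum (P : Measure Ω) (T : S2 → Ω → ℝ) {n : ℕ} (l : Fin n → ℕ) :
    KIdx l → ℂ :=
  fun m => ∫ ω, kronVec l (fun i => coeff T (l i) ω) m ∂P

/-- The rotated spectral moment `E[D^{l₁}(g) a_{l₁·} ⊗ ⋯ ⊗ D^{lₙ}(g) a_{lₙ·}]`. -/
noncomputable def rotatedPolyspectrum (P : Measure Ω) (T : S2 → Ω → ℝ) {n : ℕ}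
    (l : Fin n → ℕ) (g : SO3) : KIdx l → ℂ :=
  fun m => ∫ ω, kronVec l (fun i => (wignerD (l i) g).mulVec (coeff T (l i) ω)) m ∂P

end Field

end Polyspectra

namespace Polyspectra

/-! ### Rotations of the sphere -/

/-! Let `M(x) = E[T(x₁)⋯T(xₙ)]`. A bound on `sup E|T|^n` makes `M` integrable on `(S²)ⁿ`, and Fubini
identifies the polyspectrum with its coefficients against `conj (Y_{l₁m₁} ⊗ ⋯ ⊗ Y_{lₙmₙ})`
(`polyspectrum_eq`). The field `T(g⁻¹ ·)` has coefficient vectors `D^l(g) a_l`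
(`wignerD_mulVec_coeff`), so `Δ(g) S` is the polyspectrum of the rotated field.

Strong isotropy makes `M` rotation invariant, whence `Δ(g) S = S`; averaging over `g` gives `Δ S =
S`. Conversely, left invariance of Haar measure gives `Δ(g) Δ = Δ` (`DeltaAt_mul_Delta`), so a
vector fixed by `Δ` is fixed by every `Δ(g)`. Then `M` and `M ∘ g` have equal coefficients, and
completeness of products of harmonics gives `M = M ∘ g` almost everywhere. Under continuity in
probability `M` is continuous in each variable separately, which upgrades this to equality
everywhere (`eq_zero_of_ae_of_separately_continuous`).

The explicit `Y_{lm}` must be shown orthonormal, with rotation invariant span in each degree.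
Orthonormality reduces to Legendre integrals, because the third coordinate is uniformly distributed.
Harmonics of degree at most `L` span the polynomials of degree at most `L`, a rotation invariant
space; orthogonality then isolates degree `l` (`sphHarm_rotate_inv`). -/

theorem rotate_apply (g : SO3) (x : S2) (i : Fin 3) :
    (rotate g x).1 i = ∑ j, g.1 i j * x.1 j := rfl

theorem S2.ext_coord {x y : S2} (h : ∀ i, x.1 i = y.1 i) : x = y := by
  apply Subtype.ext
  ext i
  exact h i

theorem rotate_one (x : S2) : rotate 1 x = x := by
  apply Subtype.ext
  simp [rotate]

theorem rotate_mul (g h : SO3) (x : S2) : rotate (g * h) x = rotate g (rotate h x) := by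
  apply Subtype.ext
  simp [rotate]

theorem rotate_inv_rotate (g : SO3) (x : S2) : rotate g⁻¹ (rotate g x) = x := by
  rw [← rotate_mul, inv_mul_cancel, rotate_one]

theorem rotate_rotate_inv (g : SO3) (x : S2) : rotate g (rotate g⁻¹ x) = x := by
  rw [← rotate_mul, mul_inv_cancel, rotate_one]

theorem continuous_coord (i : Fin 3) : Continuous fun x : S2 => x.1 i := by
  fun_prop

theorem continuous_rotate_uncurry : Continuous fun p : SO3 × S2 => rotate p.1 p.2 := by
  refine Continuous.subtype_mk ?_ _
  refine (PiLp.continuous_toLp 2 _).comp ?_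
  refine continuous_pi fun i => ?_
  change Continuous fun p : SO3 × S2 => ∑ j, p.1.1 i j * p.2.1 j
  refine continuous_finsetSum _ fun j _ => ?_
  refine Continuous.mul ?_ ((continuous_coord j).comp continuous_snd)
  exact (continuous_subtype_val.comp continuous_fst).matrix_elem i j

theorem continuous_rotate (g : SO3) : Continuous (rotate g) :=
  continuous_rotate_uncurry.comp (Continuous.prodMk_right g)

/-- A rotation as a linear isometry of `ℝ³`. -/
noncomputable def rotateIsometry (g : SO3) :
    EuclideanSpace ℝ (Fin 3) ≃ₗᵢ[ℝ] EuclideanSpace ℝ (Fin 3) :=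
  LinearIsometry.toLinearIsometryEquiv
    { toFun := fun x => WithLp.toLp 2 (g.1.mulVec x.ofLp)
      map_add' := fun x y => by simp [Matrix.mulVec_add]
      map_smul' := fun c x => by simp [Matrix.mulVec_smul]
      norm_map' := fun x => norm_rotate g x } rfl

theorem rotateIsometry_coe (g : SO3) (x : S2) : rotateIsometry g x.1 = (rotate g x).1 := rfl

instance : IsFiniteMeasure surf := inferInstanceAs (IsFiniteMeasure (Measure.toSphere _))

instance : surf.IsOpenPosMeasure := inferInstanceAs (Measure.toSphere _).IsOpenPosMeasure

-- The surface measure of a set is a multiple of the volume of the cone over it, and a linear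
-- isometry carries cones to cones and preserves volume.
open scoped Pointwise in
theorem measurePreserving_rotate (g : SO3) : MeasurePreserving (rotate g) surf surf := by
  refine ⟨(continuous_rotate g).measurable, ?_⟩
  ext s hs
  rw [Measure.map_apply (continuous_rotate g).measurable hs, surf, Measure.toSphere_apply' _ hs,
    Measure.toSphere_apply' _ ((continuous_rotate g).measurable hs)]
  congr 1
  have key : Set.Ioo (0 : ℝ) 1 • ((↑) '' (rotate g ⁻¹' s) : Set (EuclideanSpace ℝ (Fin 3))) =
      rotateIsometry g ⁻¹' (Set.Ioo (0 : ℝ) 1 • ((↑) '' s)) := by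
    ext y
    simp only [Set.mem_smul, Set.mem_image, Set.mem_preimage]
    constructor
    · rintro ⟨r, hr, _, ⟨x, hx, rfl⟩, rfl⟩
      exact ⟨r, hr, _, ⟨rotate g x, hx, rfl⟩, by rw [map_smul, rotateIsometry_coe]⟩
    · rintro ⟨r, hr, _, ⟨x, hx, rfl⟩, h⟩
      refine ⟨r, hr, _, ⟨rotate g⁻¹ x, by simpa [rotate_rotate_inv] using hx, rfl⟩, ?_⟩
      apply (rotateIsometry g).injective
      rw [map_smul, rotateIsometry_coe, rotate_rotate_inv, h]
  rw [key]
  exact (rotateIsometry g).measurePreserving.measure_preimage_emb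
    (rotateIsometry g).toHomeomorph.measurableEmbedding _

theorem integral_rotate {E : Type*} [NormedAddCommGroup E] [NormedSpace ℝ E] (g : SO3)
    (f : S2 → E) : ∫ x, f (rotate g x) ∂surf = ∫ x, f x ∂surf := by
  have he : MeasurableEmbedding (rotate g) :=
    (Homeomorph.mk ⟨rotate g, rotate g⁻¹, rotate_inv_rotate g, rotate_rotate_inv g⟩
      (continuous_rotate g) (continuous_rotate g⁻¹)).measurableEmbedding
  exact (measurePreserving_rotate g).integral_comp he f

theorem integrable_of_continuous_sphere {E : Type*} [NormedAddCommGroup E] {f : S2 → E}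
    (hf : Continuous f) : Integrable f surf :=
  hf.integrable_of_hasCompactSupport (HasCompactSupport.of_compactSpace f)

theorem surf_real_univ : surf.real Set.univ = 4 * Real.pi := by
  rw [surf, Measure.toSphere_real_apply_univ, measureReal_def,
    EuclideanSpace.volume_ball_fin_three]
  simp only [finrank_euclideanSpace, Fintype.card_fin, Nat.cast_ofNat, ENNReal.ofReal_one, one_pow,
    one_mul]
  rw [ENNReal.toReal_ofReal (by positivity)]
  ring

theorem coord_sq_sum (x : S2) : x.1 0 ^ 2 + x.1 1 ^ 2 + x.1 2 ^ 2 = 1 := by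
  have h := EuclideanSpace.real_norm_sq_eq x.1
  rw [mem_sphere_zero_iff_norm.1 x.2, Fin.sum_univ_three] at h
  linarith

theorem mem_SO3_of (A : Matrix (Fin 3) (Fin 3) ℝ) (h : A * A.transpose = 1) (hd : A.det = 1) :
    A ∈ Matrix.specialOrthogonalGroup (Fin 3) ℝ := by
  rw [Matrix.mem_specialOrthogonalGroup_iff, Matrix.mem_orthogonalGroup_iff]
  exact ⟨by simpa [Matrix.star_eq_conjTranspose] using h, hd⟩

/-- The rotation about the third axis with cosine `c` and sine `s`. -/
noncomputable def rotZ (c s : ℝ) (h : c ^ 2 + s ^ 2 = 1) : SO3 :=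
  ⟨!![c, -s, 0; s, c, 0; 0, 0, 1], by
    apply mem_SO3_of
    · ext i j
      fin_cases i <;> fin_cases j <;> simp [Matrix.mul_apply, Fin.sum_univ_three] <;> linarith
    · simp [Matrix.det_fin_three]; linarith⟩

/-- The rotation about the second axis with cosine `c` and sine `s`. -/
noncomputable def rotY (c s : ℝ) (h : c ^ 2 + s ^ 2 = 1) : SO3 :=
  ⟨!![c, 0, -s; 0, 1, 0; s, 0, c], by
    apply mem_SO3_of
    · ext i j
      fin_cases i <;> fin_cases j <;> simp [Matrix.mul_apply, Fin.sum_univ_three] <;> linarith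
    · simp [Matrix.det_fin_three]; linarith⟩

section coords
variable (c s : ℝ) (h : c ^ 2 + s ^ 2 = 1) (x : S2)

theorem rotZ_zero : (rotate (rotZ c s h) x).1 0 = c * x.1 0 - s * x.1 1 := by
  rw [rotate_apply]; simp [rotZ, Fin.sum_univ_three]; ring
theorem rotZ_one : (rotate (rotZ c s h) x).1 1 = s * x.1 0 + c * x.1 1 := by
  rw [rotate_apply]; simp [rotZ, Fin.sum_univ_three]
theorem rotZ_two : (rotate (rotZ c s h) x).1 2 = x.1 2 := by
  rw [rotate_apply]; simp [rotZ, Fin.sum_univ_three]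
theorem rotY_zero : (rotate (rotY c s h) x).1 0 = c * x.1 0 - s * x.1 2 := by
  rw [rotate_apply]; simp [rotY, Fin.sum_univ_three]; ring
theorem rotY_one : (rotate (rotY c s h) x).1 1 = x.1 1 := by
  rw [rotate_apply]; simp [rotY, Fin.sum_univ_three]
theorem rotY_two : (rotate (rotY c s h) x).1 2 = s * x.1 0 + c * x.1 2 := by
  rw [rotate_apply]; simp [rotY, Fin.sum_univ_three]

end coords

theorem exists_cos_sin (a b : ℝ) :
    ∃ c s : ℝ, c ^ 2 + s ^ 2 = 1 ∧ c * a - s * b = Real.sqrt (a ^ 2 + b ^ 2) ∧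
      s * a + c * b = 0 := by
  by_cases h : a ^ 2 + b ^ 2 = 0
  · have ha : a = 0 := by nlinarith [sq_nonneg a, sq_nonneg b]
    have hb : b = 0 := by nlinarith [sq_nonneg a, sq_nonneg b]
    exact ⟨1, 0, by simp, by simp [ha, hb], by simp [hb]⟩
  · have hp : 0 < a ^ 2 + b ^ 2 := by positivity
    have hr := Real.sqrt_pos.2 hp
    have hs := Real.sq_sqrt hp.le
    refine ⟨a / Real.sqrt (a ^ 2 + b ^ 2), -b / Real.sqrt (a ^ 2 + b ^ 2), ?_, ?_, ?_⟩
    · field_simp; linarith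
    · field_simp; linarith
    · field_simp; ring

/-- The north pole. -/
noncomputable def northPole : S2 := ⟨WithLp.toLp 2 ![0, 0, 1], by
  rw [mem_sphere_zero_iff_norm, EuclideanSpace.norm_eq]; simp [Fin.sum_univ_three]⟩

/-- A turn about the third axis kills the second coordinate; a turn about the second axis then kills
the first. -/
theorem exists_rotate_eq_northPole (x : S2) : ∃ g : SO3, rotate g x = northPole := by
  obtain ⟨c, s, h, h0, h1⟩ := exists_cos_sin (x.1 0) (x.1 1)
  set y := rotate (rotZ c s h) x with hy
  have hy1 : y.1 1 = 0 := by rw [hy, rotZ_one, h1]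
  obtain ⟨c', s', h', h0', h1'⟩ := exists_cos_sin (y.1 2) (y.1 0)
  -- The angle was chosen for the pair (third, first) coordinate, the reverse of the orientation of
  -- `rotY`; hence the sign of the sine.
  refine ⟨rotY c' (-s') (by linarith) * rotZ c s h, ?_⟩
  rw [rotate_mul, ← hy]
  have hsum := coord_sq_sum y
  apply S2.ext_coord
  intro i
  fin_cases i
  · change (rotate _ y).1 0 = 0
    rw [rotY_zero]; linarith
  · change (rotate _ y).1 1 = 0
    rw [rotY_one, hy1]
  · change (rotate _ y).1 2 = 1
    rw [rotY_two]
    have : y.1 2 ^ 2 + y.1 0 ^ 2 = 1 := by rw [hy1] at hsum; linarith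
    rw [this, Real.sqrt_one] at h0'
    linarith

/-! ### Moments of the third coordinate -/

/-- `∫ x₂ᵏ dx` over the sphere. -/
noncomputable def zMoment (k : ℕ) : ℝ := ∫ x : S2, x.1 2 ^ k ∂surf

theorem zMoment_zero : zMoment 0 = 4 * Real.pi := by
  simp [zMoment, surf_real_univ]

theorem zMoment_odd {k : ℕ} (hk : Odd k) : zMoment k = 0 := by
  have h := integral_rotate (rotY (-1) 0 (by norm_num)) (fun x : S2 => x.1 2 ^ k)
  have h2 : (fun x : S2 => (rotate (rotY (-1) 0 (by norm_num)) x).1 2 ^ k) =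
      fun x : S2 => -(x.1 2 ^ k) := by
    funext x
    rw [rotY_two, zero_mul, zero_add, neg_one_mul, hk.neg_pow]
  rw [h2, integral_neg] at h
  rw [zMoment]
  linarith

/-- `s x₀ + x₂` is `√(1 + s²)` times the third coordinate of a rotated point. -/
theorem integral_linear_pow (s : ℝ) (j : ℕ) :
    ∫ x : S2, (s * x.1 0 + x.1 2) ^ (2 * j) ∂surf = zMoment (2 * j) * (1 + s ^ 2) ^ j := by
  have hp : 0 < 1 + s ^ 2 := by positivity
  have hr := Real.sqrt_pos.2 hp
  have hs := Real.sq_sqrt hp.le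
  set r := Real.sqrt (1 + s ^ 2)
  have hcs : (1 / r) ^ 2 + (s / r) ^ 2 = 1 := by field_simp; linarith
  have h := integral_rotate (rotY (1 / r) (s / r) hcs) (fun x : S2 => x.1 2 ^ (2 * j))
  rw [zMoment, ← h, ← integral_mul_const]
  congr 1
  funext x
  rw [rotY_two, pow_mul, pow_mul, ← mul_pow]
  congr 1
  rw [← hs]
  field_simp

/-- A quarter turn exchanges the roles of `x₀²` and `x₁²`, whose sum is `1 - x₂²`. -/
theorem integral_sq_mul_pow (k : ℕ) :
    ∫ x : S2, x.1 0 ^ 2 * x.1 2 ^ k ∂surf = (zMoment k - zMoment (k + 2)) / 2 := by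
  have h := integral_rotate (rotZ 0 1 (by norm_num)) (fun x : S2 => x.1 1 ^ 2 * x.1 2 ^ k)
  simp only [rotZ_one, rotZ_two, one_mul, zero_mul, add_zero] at h
  have hi : ∀ i : Fin 3, Integrable (fun x : S2 => x.1 i ^ 2 * x.1 2 ^ k) surf := fun i =>
    integrable_of_continuous_sphere (((continuous_coord i).pow 2).mul ((continuous_coord 2).pow k))
  have hsum : zMoment k = ∫ x : S2, (x.1 0 ^ 2 * x.1 2 ^ k + x.1 1 ^ 2 * x.1 2 ^ k) +
      x.1 2 ^ 2 * x.1 2 ^ k ∂surf := by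
    rw [zMoment]
    congr 1
    funext x
    have := coord_sq_sum x
    linear_combination (-x.1 2 ^ k) * this
  rw [integral_add (f := fun x : S2 => x.1 0 ^ 2 * x.1 2 ^ k + x.1 1 ^ 2 * x.1 2 ^ k)
    ((hi 0).add (hi 1)) (hi 2), integral_add (hi 0) (hi 1), ← h] at hsum
  have h2 : ∫ x : S2, x.1 2 ^ 2 * x.1 2 ^ k ∂surf = zMoment (k + 2) := by
    rw [zMoment]; congr 1; funext x; ring
  rw [h2] at hsum
  linarith

/-- Both sides of `integral_linear_pow` are polynomials in `s`. Comparing coefficients of `s²`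
relates consecutive even moments, with no recourse to spherical coordinates. -/
theorem zMoment_even_succ (j : ℕ) :
    (2 * j + 3) * zMoment (2 * (j + 1)) = (2 * j + 1) * zMoment (2 * j) := by
  have hpoly : (∑ i ∈ Finset.range (2 * (j + 1) + 1),
      Polynomial.monomial i ((∫ x : S2, x.1 0 ^ i * x.1 2 ^ (2 * (j + 1) - i) ∂surf) *
        ((2 * (j + 1)).choose i : ℝ))) =
      Polynomial.C (zMoment (2 * (j + 1))) * (1 + Polynomial.X ^ 2) ^ (j + 1) := by
    apply Polynomial.funext
    intro s
    rw [Polynomial.eval_mul, Polynomial.eval_pow, Polynomial.eval_finsetSum]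
    simp only [Polynomial.eval_C, Polynomial.eval_add, Polynomial.eval_one, Polynomial.eval_pow,
      Polynomial.eval_X, Polynomial.eval_monomial]
    rw [← integral_linear_pow]
    simp_rw [add_pow]
    rw [integral_finsetSum]
    · refine Finset.sum_congr rfl fun i _ => ?_
      rw [← integral_mul_const, ← integral_mul_const]
      congr 1
      funext x
      ring
    · intro i _
      apply integrable_of_continuous_sphere
      have := continuous_coord
      fun_prop
  have h := congrArg (fun p => Polynomial.coeff p 2) hpoly
  simp only [Polynomial.finsetSum_coeff, Polynomial.coeff_monomial, Polynomial.coeff_C_mul] at h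
  rw [Finset.sum_ite_eq' , if_pos (by simp)] at h
  have hc : ((1 + Polynomial.X ^ 2 : Polynomial ℝ) ^ (j + 1)).coeff 2 = j + 1 := by
    have : (1 + Polynomial.X ^ 2 : Polynomial ℝ) ^ (j + 1) =
        Polynomial.expand ℝ 2 ((1 + Polynomial.X) ^ (j + 1)) := by simp
    rw [this, show (2 : ℕ) = 1 * 2 from rfl, Polynomial.coeff_expand_mul (by norm_num),
      Polynomial.coeff_one_add_X_pow]
    simp
  rw [hc, show 2 * (j + 1) - 2 = 2 * j by omega, integral_sq_mul_pow, Nat.cast_choose_two] at h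
  push_cast at h
  have hj : (j + 1 : ℝ) ≠ 0 := by positivity
  rw [show 2 * j + 2 = 2 * (j + 1) by ring] at h
  apply mul_left_cancel₀ hj
  linear_combination (-2) * h

theorem zMoment_even (j : ℕ) : zMoment (2 * j) = 4 * Real.pi / (2 * j + 1) := by
  induction j with
  | zero => simp [zMoment_zero]
  | succ j ih =>
    have h := zMoment_even_succ j
    rw [ih] at h
    have h1 : (2 * j + 1 : ℝ) ≠ 0 := by positivity
    have h3 : (2 * j + 3 : ℝ) ≠ 0 := by positivity
    push_cast
    rw [eq_div_iff (by positivity)]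
    field_simp at h
    linear_combination h

/-- The distribution of the third coordinate under the surface measure is uniform. -/
theorem integral_polynomial_coord (p : Polynomial ℝ) :
    ∫ x : S2, p.eval (x.1 2) ∂surf = 2 * Real.pi * ∫ t in (-1 : ℝ)..1, p.eval t := by
  induction p using Polynomial.induction_on' with
  | add p q hp hq =>
    have hc : ∀ p : Polynomial ℝ, Integrable (fun x : S2 => p.eval (x.1 2)) surf := fun p =>
      integrable_of_continuous_sphere (p.continuous.comp (continuous_coord 2))
    simp only [Polynomial.eval_add]
    rw [integral_add (hc p) (hc q), intervalIntegral.integral_add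
      (p.continuous.intervalIntegrable _ _) (q.continuous.intervalIntegrable _ _), hp, hq]
    ring
  | monomial k a =>
    simp only [Polynomial.eval_monomial]
    rw [integral_const_mul, intervalIntegral.integral_const_mul, integral_pow]
    change a * zMoment k = _
    rcases Nat.even_or_odd k with hk | hk
    · have h1 : Odd (k + 1) := hk.add_one
      obtain ⟨j, rfl⟩ := hk
      rw [← two_mul, zMoment_even]
      rw [← two_mul] at h1
      rw [h1.neg_pow]
      push_cast
      ring
    · have h1 : Even (k + 1) := hk.add_one
      rw [zMoment_odd hk, h1.neg_pow]
      simp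

/-! ### Legendre polynomials -/

-- `u = (X² - 1)^l` satisfies `(X² - 1) u' = 2l X u`; the identity is this equation differentiated
-- `k + 1` times.
open Polynomial in
theorem rodrigues_ode (l k : ℕ) :
    (X ^ 2 - 1 : ℝ[X]) * derivative^[k + 2] ((X ^ 2 - 1) ^ l) +
      C (2 * ((k : ℝ) + 1 - l)) * X * derivative^[k + 1] ((X ^ 2 - 1) ^ l) +
      C (((k : ℝ) + 1) * (k - 2 * l)) * derivative^[k] ((X ^ 2 - 1) ^ l) = 0 := by
  set u : ℝ[X] := (X ^ 2 - 1) ^ l with hu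
  have h0 : (X ^ 2 - 1 : ℝ[X]) * derivative u = C (2 * (l : ℝ)) * X * u := by
    rw [hu, derivative_pow]
    rcases l with _ | l
    · simp
    · simp only [Nat.add_sub_cancel, derivative_sub, derivative_pow, derivative_one,
        derivative_X, map_mul, map_natCast, C_ofNat]
      ring
  induction k with
  | zero =>
    have h1 := congrArg derivative h0
    simp only [derivative_mul, derivative_sub, derivative_pow, derivative_one, derivative_X,
      derivative_C] at h1
    simp only [Function.iterate_succ, Function.iterate_zero, Function.comp, id]
    simp only [map_mul, map_sub, map_add, map_natCast, C_ofNat, map_one, Nat.cast_zero] at h1 ⊢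
    simp only [map_zero]
    push_cast at h1
    linear_combination h1
  | succ k ih =>
    have h1 := congrArg derivative ih
    simp only [derivative_mul, derivative_sub, derivative_pow, derivative_one, derivative_X,
      derivative_C, derivative_add, ← Function.iterate_succ_apply' derivative, derivative_zero] at h1
    simp only [Nat.succ_eq_add_one] at h1
    rw [show k + 1 + 2 = k + 2 + 1 from rfl, show k + 1 + 1 = k + 2 from rfl]
    rw [show k + 1 + 1 = k + 2 from rfl] at h1
    simp only [map_mul, map_sub, map_add, map_natCast, C_ofNat, map_one, Nat.cast_succ] at h1 ⊢
    push_cast at h1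
    linear_combination h1

open Polynomial in
theorem iterate_derivative_legendre (l m : ℕ) :
    derivative^[m] (legendre l) =
      C (1 / (2 ^ l * (l.factorial : ℝ))) * derivative^[l + m] ((X ^ 2 - 1) ^ l) := by
  rw [legendre, iterate_derivative_C_mul, add_comm, Function.iterate_add_apply]

-- The associated Legendre equation in self-adjoint form: `rodrigues_ode` at order `l + m`,
-- multiplied by the weight `-(1 - X²)^m`.
open Polynomial in
theorem legendre_ode (l m : ℕ) :
    derivative ((1 - X ^ 2) ^ (m + 1) * derivative^[m + 1] (legendre l)) =
      C (((m : ℝ) - l) * (l + m + 1)) * ((1 - X ^ 2) ^ m * derivative^[m] (legendre l)) := by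
  have h := rodrigues_ode l (l + m)
  rw [derivative_mul, ← Function.iterate_succ_apply' derivative]
  simp only [Nat.succ_eq_add_one, iterate_derivative_legendre, ← add_assoc, derivative_pow,
    derivative_sub, derivative_one, derivative_X]
  simp only [map_mul, map_sub, map_add, map_natCast, C_ofNat, map_one, Nat.cast_add,
    Nat.add_sub_cancel, Nat.cast_one] at h ⊢
  push_cast
  linear_combination (-(1 - X ^ 2) ^ m * C (1 / (2 ^ l * (l.factorial : ℝ)))) * h

/-- The integral of a polynomial over `[-1, 1]`, as a linear form. -/
noncomputable def polyInt : Polynomial ℝ →ₗ[ℝ] ℝ where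
  toFun p := ∫ t in (-1 : ℝ)..1, p.eval t
  map_add' p q := by
    simp only [Polynomial.eval_add]
    exact intervalIntegral.integral_add (p.continuous.intervalIntegrable _ _)
      (q.continuous.intervalIntegrable _ _)
  map_smul' a p := by simp [intervalIntegral.integral_const_mul]

theorem polyInt_derivative (p : Polynomial ℝ) :
    polyInt (Polynomial.derivative p) = p.eval 1 - p.eval (-1) :=
  intervalIntegral.integral_eq_sub_of_hasDerivAt (fun t _ => p.hasDerivAt t)
    ((Polynomial.derivative p).continuous.intervalIntegrable _ _)

theorem polyInt_mul_derivative {p : Polynomial ℝ} (h1 : p.eval 1 = 0) (h2 : p.eval (-1) = 0)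
    (q : Polynomial ℝ) :
    polyInt (p * Polynomial.derivative q) = -polyInt (Polynomial.derivative p * q) := by
  have h := polyInt_derivative (p * q)
  rw [Polynomial.derivative_mul, map_add, Polynomial.eval_mul, Polynomial.eval_mul, h1, h2] at h
  linarith

theorem polyInt_C_mul (a : ℝ) (p : Polynomial ℝ) :
    polyInt (Polynomial.C a * p) = a * polyInt p := by
  rw [← Polynomial.smul_eq_C_mul, map_smul, smul_eq_mul]

-- Integration by parts: the factor `(1 - X²)^(m+1)` kills the boundary terms, and the differential
-- equation returns the expression of order `m`.
open Polynomial in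
theorem polyInt_assoc_succ (l m : ℕ) (q : ℝ[X]) :
    polyInt ((1 - X ^ 2) ^ (m + 1) * derivative^[m + 1] (legendre l) * derivative q) =
      (((l : ℝ) - m) * (l + m + 1)) * polyInt ((1 - X ^ 2) ^ m * derivative^[m] (legendre l) * q) := by
  rw [polyInt_mul_derivative (by simp) (by simp), legendre_ode, mul_assoc (C _), polyInt_C_mul]
  ring

-- Iterating the previous step, the factors `(l - j)(l + j + 1)`, `j < m`, multiply to the quotient
-- of factorials.
open Polynomial in
theorem polyInt_assoc {l m : ℕ} (hm : m ≤ l) (q : ℝ[X]) :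
    polyInt ((1 - X ^ 2) ^ m * derivative^[m] (legendre l) * derivative^[m] q) =
      ((l + m).factorial : ℝ) / (l - m).factorial * polyInt (legendre l * q) := by
  induction m with
  | zero =>
    have : (l.factorial : ℝ) ≠ 0 := by positivity
    simp [this]
  | succ m ih =>
    rw [Function.iterate_succ_apply' derivative m q, polyInt_assoc_succ, ih (by omega)]
    have h1 : ((l - m).factorial : ℝ) = ((l : ℝ) - m) * (l - (m + 1)).factorial := by
      rw [show l - m = (l - (m + 1)) + 1 by omega, Nat.factorial_succ]
      push_cast
      rw [Nat.cast_sub hm]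
      push_cast
      ring
    have h2 : ((l + (m + 1)).factorial : ℝ) = ((l : ℝ) + m + 1) * (l + m).factorial := by
      rw [← add_assoc, Nat.factorial_succ]
      push_cast
      ring
    have h3 : ((l : ℝ) - m) ≠ 0 := by
      have : (m : ℝ) + 1 ≤ l := by exact_mod_cast hm
      linarith
    have h4 : ((l - (m + 1)).factorial : ℝ) ≠ 0 := by positivity
    rw [h1, h2]
    field_simp

-- `±1` are zeros of order `l` of `(X² - 1)^l`, and fewer than `l` derivatives leave a zero there.
-- Hence no boundary terms arise in `polyInt_rodrigues`.
open Polynomial in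
theorem eval_iterate_derivative_rodrigues {l k : ℕ} (hk : k < l) {a : ℝ} (ha : a ^ 2 = 1) :
    (derivative^[k] ((X ^ 2 - 1 : ℝ[X]) ^ l)).eval a = 0 := by
  have hd : (X - C a) ^ l ∣ (X ^ 2 - 1 : ℝ[X]) ^ l := by
    apply pow_dvd_pow_of_dvd
    rw [dvd_iff_isRoot]
    simp [ha]
  have h1 : (X - C a) ^ (l - k) ∣ derivative^[k] ((X ^ 2 - 1 : ℝ[X]) ^ l) :=
    pow_sub_dvd_iterate_derivative_of_pow_dvd k hd
  have h2 : (X - C a) ∣ derivative^[k] ((X ^ 2 - 1 : ℝ[X]) ^ l) :=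
    (dvd_pow_self _ (by omega)).trans h1
  exact (dvd_iff_isRoot.1 h2)

open Polynomial in
theorem polyInt_rodrigues {l k : ℕ} (hk : k ≤ l) (q : ℝ[X]) :
    polyInt (derivative^[k] ((X ^ 2 - 1) ^ l) * q) =
      (-1) ^ k * polyInt ((X ^ 2 - 1) ^ l * derivative^[k] q) := by
  induction k generalizing q with
  | zero => simp
  | succ k ih =>
    have h := polyInt_mul_derivative
      (eval_iterate_derivative_rodrigues (l := l) (k := k) (by omega) (a := 1) (by norm_num))
      (eval_iterate_derivative_rodrigues (l := l) (k := k) (by omega) (a := -1) (by norm_num)) q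
    rw [ih (by omega), ← Function.iterate_succ_apply derivative,
      ← Function.iterate_succ_apply' derivative] at h
    rw [pow_succ (-1 : ℝ)]
    linarith

open Polynomial in
theorem polyInt_one_sub_sq_pow (l : ℕ) :
    polyInt ((1 - X ^ 2) ^ l) = 2 ^ (2 * l + 1) * (l.factorial : ℝ) ^ 2 / (2 * l + 1).factorial := by
  induction l with
  | zero =>
    have := polyInt_derivative X
    simp at this
    simp [this]
    norm_num
  | succ l ih =>
    -- Parts against `X`, followed by `X² = 1 - (1 - X²)`, gives a recursion in `l`.
    have h := polyInt_mul_derivative (p := (1 - X ^ 2) ^ (l + 1)) (by simp) (by simp) X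
    have h2 : derivative ((1 - X ^ 2 : ℝ[X]) ^ (l + 1)) * X =
        C (2 * (l + 1) : ℝ) * (1 - X ^ 2) ^ (l + 1) - C (2 * (l + 1) : ℝ) * (1 - X ^ 2) ^ l := by
      simp only [derivative_pow, derivative_sub, derivative_one, derivative_X, Nat.add_sub_cancel,
        map_mul, map_add, map_natCast, C_ofNat, map_one]
      push_cast
      ring
    rw [h2, derivative_X, mul_one, map_sub, polyInt_C_mul, polyInt_C_mul, ih] at h
    have h3 : ((2 * (l + 1) + 1).factorial : ℝ) =
        (2 * l + 3) * (2 * l + 2) * (2 * l + 1).factorial := by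
      rw [show 2 * (l + 1) + 1 = (2 * l + 1) + 1 + 1 by ring, Nat.factorial_succ, Nat.factorial_succ]
      push_cast
      ring
    have h4 : ((2 * l + 1).factorial : ℝ) ≠ 0 := by positivity
    have h5 : (2 * l + 3 : ℝ) ≠ 0 := by positivity
    rw [h3, Nat.factorial_succ, eq_div_iff (by positivity)]
    field_simp at h
    push_cast
    ring_nf at h ⊢
    linear_combination (2 * (l : ℝ) + 2) * h

open Polynomial in
theorem natDegree_rodrigues (l : ℕ) : ((X ^ 2 - 1 : ℝ[X]) ^ l).natDegree = 2 * l := by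
  rw [natDegree_pow, ← C_1, natDegree_X_pow_sub_C, mul_comm]

open Polynomial in
theorem monic_rodrigues (l : ℕ) : ((X ^ 2 - 1 : ℝ[X]) ^ l).Monic := by
  rw [← C_1]
  exact (monic_X_pow_sub_C 1 two_ne_zero).pow l

open Polynomial in
theorem polyInt_legendre_mul_of_degree_lt {l : ℕ} {q : ℝ[X]} (hq : q.degree < l) :
    polyInt (legendre l * q) = 0 := by
  rw [legendre, mul_assoc, polyInt_C_mul, polyInt_rodrigues le_rfl,
    iterate_derivative_eq_zero_of_degree_lt hq]
  simp

open Polynomial in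
theorem coeff_iterate_derivative_legendre (l m : ℕ) (hm : m ≤ l) :
    (derivative^[m] (legendre l)).coeff (l - m) ≠ 0 := by
  rw [iterate_derivative_legendre, coeff_C_mul, coeff_iterate_derivative,
    show l - m + (l + m) = 2 * l by omega]
  have h := (monic_rodrigues l).coeff_natDegree
  rw [natDegree_rodrigues] at h
  rw [h, nsmul_eq_mul, mul_one]
  have : (2 * l).descFactorial (l + m) ≠ 0 := by
    rw [Ne, Nat.descFactorial_eq_zero_iff_lt]; omega
  positivity

open Polynomial in
theorem natDegree_iterate_derivative_legendre_le (l m : ℕ) :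
    (derivative^[m] (legendre l)).natDegree ≤ l - m := by
  rw [iterate_derivative_legendre]
  refine (natDegree_C_mul_le _ _).trans ((natDegree_iterate_derivative _ _).trans ?_)
  rw [natDegree_rodrigues]
  omega

-- Moving `l` derivatives to the other factor differentiates a monic polynomial of degree `2l`
-- exactly `2l` times. The constant `(2l)!` comes out and the integral of `(1 - X²)^l` remains.
open Polynomial in
theorem polyInt_legendre_sq (l : ℕ) : polyInt (legendre l * legendre l) = 2 / (2 * l + 1) := by
  conv_lhs => rw [legendre]
  have h1 : derivative^[l] (derivative^[l] ((X ^ 2 - 1 : ℝ[X]) ^ l)) = C ((2 * l).factorial : ℝ) := by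
    rw [← Function.iterate_add_apply, ← two_mul]
    have hd : (derivative^[2 * l] ((X ^ 2 - 1 : ℝ[X]) ^ l)).natDegree ≤ 0 :=
      (natDegree_iterate_derivative _ _).trans (by rw [natDegree_rodrigues]; omega)
    have h := (monic_rodrigues l).coeff_natDegree
    rw [natDegree_rodrigues] at h
    rw [eq_C_of_natDegree_le_zero hd, coeff_iterate_derivative, zero_add, h,
      Nat.descFactorial_self, nsmul_eq_mul, mul_one]
  rw [mul_mul_mul_comm, ← C_mul, polyInt_C_mul, polyInt_rodrigues le_rfl, h1, mul_comm _ (C _),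
    polyInt_C_mul]
  have h2 : (-1 : ℝ) ^ l * ((2 * l).factorial * polyInt ((X ^ 2 - 1) ^ l)) =
      (2 * l).factorial * polyInt ((1 - X ^ 2) ^ l) := by
    have : (1 - X ^ 2 : ℝ[X]) ^ l = C ((-1) ^ l) * (X ^ 2 - 1) ^ l := by
      rw [C_pow, ← mul_pow]; congr 1; simp
    rw [this, polyInt_C_mul]
    ring
  rw [h2, polyInt_one_sub_sq_pow, Nat.factorial_succ (2 * l)]
  have h3 : ((2 * l).factorial : ℝ) ≠ 0 := by positivity
  have h4 : (l.factorial : ℝ) ≠ 0 := by positivity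
  push_cast
  field_simp
  ring

open Polynomial in
theorem polyInt_legendre_mul (l l' : ℕ) :
    polyInt (legendre l * legendre l') = if l = l' then 2 / (2 * (l : ℝ) + 1) else 0 := by
  have hlt : ∀ {a b : ℕ}, b < a → (legendre b).degree < a := fun {a b} h =>
    degree_le_natDegree.trans_lt (by
      have := natDegree_iterate_derivative_legendre_le b 0
      simp only [Function.iterate_zero, id] at this
      exact_mod_cast (this.trans_lt (by omega)))
  split_ifs with h
  · subst h; exact polyInt_legendre_sq l
  · rcases lt_or_gt_of_ne h with h | h
    · rw [mul_comm]; exact polyInt_legendre_mul_of_degree_lt (hlt h)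
    · exact polyInt_legendre_mul_of_degree_lt (hlt h)

open Polynomial in
theorem polyInt_assoc_mul_assoc {l m : ℕ} (hm : m ≤ l) (l' : ℕ) :
    polyInt ((1 - X ^ 2) ^ m * derivative^[m] (legendre l) * derivative^[m] (legendre l')) =
      if l = l' then 2 / (2 * (l : ℝ) + 1) * ((l + m).factorial / (l - m).factorial) else 0 := by
  rw [polyInt_assoc hm, polyInt_legendre_mul]
  split_ifs <;> ring

/-! ### Spherical harmonics as polynomials -/

/-- The function `x₀ + i x₁` on the sphere. -/
noncomputable def planar (x : S2) : ℂ := ⟨x.1 0, x.1 1⟩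

theorem planar_eq (x : S2) : planar x = (x.1 0 : ℂ) + (x.1 1 : ℂ) * Complex.I := by
  apply Complex.ext <;> simp [planar]

theorem conj_planar_eq (x : S2) : conj (planar x) = (x.1 0 : ℂ) - (x.1 1 : ℂ) * Complex.I := by
  apply Complex.ext <;> simp [planar]

theorem planar_mul_conj (x : S2) : planar x * conj (planar x) = 1 - (x.1 2 : ℂ) ^ 2 := by
  rw [Complex.mul_conj, planar, Complex.normSq_mk]
  have := coord_sq_sum x
  rw [show x.1 0 * x.1 0 + x.1 1 * x.1 1 = 1 - x.1 2 ^ 2 by linarith]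
  push_cast
  rfl

theorem norm_planar (x : S2) : ‖planar x‖ = Real.sqrt (1 - x.1 2 ^ 2) := by
  rw [Complex.norm_def, planar, Complex.normSq_mk]
  have := coord_sq_sum x
  congr 1
  linarith

theorem continuous_planar : Continuous planar := by
  have : planar = fun x => (x.1 0 : ℂ) + (x.1 1 : ℂ) * Complex.I := funext planar_eq
  rw [this]
  have := continuous_coord
  fun_prop

/-- `(x₀ + i x₁)ᵐ` for `m ≥ 0` and `(x₀ - i x₁)^{-m}` for `m < 0`. -/
noncomputable def azim : ℤ → S2 → ℂ
  | Int.ofNat k, x => planar x ^ k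
  | Int.negSucc k, x => conj (planar x) ^ (k + 1)

theorem continuous_azim (m : ℤ) : Continuous (azim m) := by
  rcases m with k | k
  · exact continuous_planar.pow k
  · exact (Complex.continuous_conj.comp continuous_planar).pow (k + 1)

theorem conj_azim_mul_azim (m : ℤ) (x : S2) :
    conj (azim m x) * azim m x = (1 - (x.1 2 : ℂ) ^ 2) ^ m.natAbs := by
  rcases m with k | k
  · simp [azim, ← planar_mul_conj, mul_pow, mul_comm]
  · simp [azim, ← planar_mul_conj, mul_pow]

theorem planar_mul_azim_of_nonneg {m : ℤ} (hm : 0 ≤ m) (x : S2) :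
    planar x * azim m x = azim (m + 1) x := by
  lift m to ℕ using hm
  change planar x * planar x ^ m = planar x ^ (m + 1)
  ring

/-- For negative `m` one conjugate factor is absorbed into `|x₀ + i x₁|² = 1 - x₂²`. -/
theorem planar_mul_azim_of_neg {m : ℤ} (hm : m < 0) (x : S2) :
    planar x * azim m x = (1 - (x.1 2 : ℂ) ^ 2) * azim (m + 1) x := by
  rcases m with k | k
  · exact absurd hm (by simp)
  · rw [← planar_mul_conj]
    rcases k with _ | k
    · change planar x * conj (planar x) ^ 1 = _ * planar x ^ 0
      ring
    · change planar x * conj (planar x) ^ (k + 2) = _ * conj (planar x) ^ (k + 1)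
      ring

theorem conj_azim (m : ℤ) (x : S2) : conj (azim m x) = azim (-m) x := by
  rcases m with k | k
  · rcases k with _ | k
    · simp [azim]
    · change conj (planar x ^ (k + 1)) = conj (planar x) ^ (k + 1)
      simp
  · change conj (conj (planar x) ^ (k + 1)) = planar x ^ (k + 1)
    simp

/-- The coefficient of `azim m * (d/dt)^|m| P_l` in `Y_{lm}`. -/
noncomputable def harmConst (l : ℕ) (m : ℤ) : ℝ :=
  (if 0 ≤ m then (-1) ^ m.natAbs else 1) * Real.sqrt ((2 * l + 1) / (4 * Real.pi) *
    ((l - m.natAbs).factorial / (l + m.natAbs).factorial))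

theorem harmConst_sq (l : ℕ) (m : ℤ) : harmConst l m ^ 2 = (2 * l + 1) / (4 * Real.pi) *
    ((l - m.natAbs).factorial / (l + m.natAbs).factorial) := by
  rw [harmConst, mul_pow, Real.sq_sqrt (by positivity)]
  split_ifs <;> simp [← pow_mul]

theorem harmConst_ne_zero (l : ℕ) (m : ℤ) : harmConst l m ≠ 0 := by
  have h : harmConst l m ^ 2 ≠ 0 := by rw [harmConst_sq]; positivity
  exact fun h0 => h (by simp [h0])

/-- `√(1 - x₂²)` is the modulus of `x₀ + i x₁`, so polar decomposition turns the half-power and the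
exponential into `(x₀ + i x₁)^m`. This removes the discontinuous argument and shows that harmonics
are polynomials. -/
theorem sphHarmNat_eq (l m : ℕ) (x : S2) :
    sphHarmNat l m x = ((-1) ^ m * Real.sqrt ((2 * l + 1) / (4 * Real.pi) *
      ((l - m).factorial / (l + m).factorial)) : ℝ) * planar x ^ m *
      ((Polynomial.derivative^[m] (legendre l)).eval (x.1 2) : ℝ) := by
  have h : planar x ^ m = (Real.sqrt (1 - x.1 2 ^ 2) : ℂ) ^ m *
      Complex.exp (Complex.I * m * Complex.arg (planar x)) := by
    rw [mul_assoc, mul_comm Complex.I, mul_assoc, Complex.exp_nat_mul, ← mul_pow, ← norm_planar,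
      Complex.norm_mul_exp_arg_mul_I]
  rw [h, sphHarmNat, assocLegendre]
  change _ * Complex.exp (Complex.I * m * Complex.arg (planar x)) = _
  push_cast
  ring

theorem sphHarm_eq (l : ℕ) (m : ℤ) (x : S2) :
    sphHarm l m x = harmConst l m * azim m x *
      ((Polynomial.derivative^[m.natAbs] (legendre l)).eval (x.1 2) : ℝ) := by
  rcases m with k | k
  · have h : (0 : ℤ) ≤ Int.ofNat k := by simp
    rw [sphHarm, if_pos h, harmConst, if_pos h]
    exact sphHarmNat_eq l k x
  · have h : ¬ (0 : ℤ) ≤ Int.negSucc k := by simp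
    rw [sphHarm, if_neg h, harmConst, if_neg h]
    simp only [Int.natAbs_negSucc, Nat.succ_eq_add_one, one_mul]
    rw [sphHarmNat_eq]
    simp only [map_mul, Complex.conj_ofReal, map_pow, azim]
    -- For negative order the sign in the definition of `Y_{lm}` cancels that of the associated
    -- Legendre function, so `harmConst` carries no sign.
    have : ((-1 : ℂ) ^ (k + 1)) * (-1) ^ (k + 1) = 1 := by rw [← mul_pow]; simp
    push_cast
    linear_combination (Real.sqrt ((2 * l + 1) / (4 * Real.pi) *
      ((l - (k + 1)).factorial / (l + (k + 1)).factorial)) : ℂ) * conj (planar x) ^ (k + 1) *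
      (((Polynomial.derivative^[k + 1] (legendre l)).eval (x.1 2) : ℝ) : ℂ) * this

theorem continuous_sphHarm (l : ℕ) (m : ℤ) : Continuous (sphHarm l m) := by
  have h : sphHarm l m = fun x => harmConst l m * azim m x *
      ((Polynomial.derivative^[m.natAbs] (legendre l)).eval (x.1 2) : ℝ) :=
    funext (sphHarm_eq l m)
  rw [h]
  exact (continuous_const.mul (continuous_azim m)).mul
    (Complex.continuous_ofReal.comp ((Polynomial.continuous _).comp (continuous_coord 2)))

theorem MIdx.natAbs_le {l : ℕ} (m : MIdx l) : m.1.natAbs ≤ l := by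
  have := Finset.mem_Icc.1 m.2
  omega

/-! ### Orthonormality -/

/-- The inner product of `L²(S²)`. -/
noncomputable def sphInner (f h : S2 → ℂ) : ℂ := ∫ x, conj (f x) * h x ∂surf

theorem sphInner_rotate (g : SO3) (f h : S2 → ℂ) :
    sphInner (fun x => f (rotate g x)) (fun x => h (rotate g x)) = sphInner f h :=
  integral_rotate g fun x => conj (f x) * h x

theorem sphInner_conj_symm (f h : S2 → ℂ) : conj (sphInner f h) = sphInner h f := by
  rw [sphInner, sphInner, ← integral_conj]
  congr 1
  funext x
  simp [mul_comm]

theorem integrable_conj_mul {f h : S2 → ℂ} (hf : Continuous f) (hh : Continuous h) :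
    Integrable (fun x => conj (f x) * h x) surf :=
  integrable_of_continuous_sphere ((Complex.continuous_conj.comp hf).mul hh)

theorem sphInner_add_right {f h k : S2 → ℂ} (hf : Continuous f) (hh : Continuous h)
    (hk : Continuous k) : sphInner f (h + k) = sphInner f h + sphInner f k := by
  simp only [sphInner, Pi.add_apply, mul_add]
  exact integral_add (integrable_conj_mul hf hh) (integrable_conj_mul hf hk)

theorem sphInner_smul_right (c : ℂ) (f h : S2 → ℂ) : sphInner f (c • h) = c * sphInner f h := by
  simp only [sphInner, Pi.smul_apply, smul_eq_mul]
  rw [← integral_const_mul]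
  congr 1
  funext x
  ring

theorem azim_rotZ (c s : ℝ) (h : c ^ 2 + s ^ 2 = 1) (m : ℤ) (x : S2) :
    azim m (rotate (rotZ c s h) x) = (c + s * Complex.I) ^ m * azim m x := by
  have hp : planar (rotate (rotZ c s h) x) = (c + s * Complex.I) * planar x := by
    rw [planar_eq, planar_eq, rotZ_zero, rotZ_one]
    push_cast
    linear_combination (-(s : ℂ) * x.1 1) * Complex.I_sq
  rcases m with k | k
  · simp [azim, hp, mul_pow]
  · have hn : conj (c + s * Complex.I) = (c + s * Complex.I)⁻¹ := by
      rw [eq_comm, inv_eq_of_mul_eq_one_right]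
      simp only [map_add, map_mul, Complex.conj_ofReal, Complex.conj_I]
      have : (c : ℂ) ^ 2 + s ^ 2 = 1 := by exact_mod_cast h
      linear_combination this - (s : ℂ) ^ 2 * Complex.I_sq
    rw [zpow_negSucc, ← inv_pow, ← hn]
    simp [azim, hp, mul_pow]

/-- A rotation by `θ` about the third axis multiplies the integrand by `exp(i(m' - m)θ)` without
changing the integral. The chosen `θ` makes this factor `-1`. -/
theorem sphInner_sphHarm_of_ne (l l' : ℕ) {m m' : ℤ} (hm : m ≠ m') :
    sphInner (sphHarm l m) (sphHarm l' m') = 0 := by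
  set θ : ℝ := Real.pi / (m' - m) with hθ
  have h := sphInner_rotate (rotZ (Real.cos θ) (Real.sin θ) (Real.cos_sq_add_sin_sq θ))
    (sphHarm l m) (sphHarm l' m')
  have hζ : (Real.cos θ + Real.sin θ * Complex.I : ℂ) = Complex.exp (θ * Complex.I) := by
    rw [Complex.exp_mul_I]; push_cast; rfl
  have hd : (m' - m : ℂ) ≠ 0 := by
    rw [sub_ne_zero]; exact_mod_cast hm.symm
  have he : conj (Complex.exp (θ * Complex.I) ^ m) * Complex.exp (θ * Complex.I) ^ m' = -1 := by
    rw [← Complex.exp_int_mul, ← Complex.exp_int_mul, ← Complex.exp_conj, ← Complex.exp_add,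
      ← Complex.exp_pi_mul_I]
    congr 1
    simp only [map_mul, Complex.conj_I, Complex.conj_ofReal, map_intCast]
    rw [hθ]
    push_cast
    field_simp
    ring
  have h2 : sphInner (fun x => sphHarm l m (rotate (rotZ (Real.cos θ) (Real.sin θ)
      (Real.cos_sq_add_sin_sq θ)) x)) (fun x => sphHarm l' m' (rotate (rotZ (Real.cos θ)
      (Real.sin θ) (Real.cos_sq_add_sin_sq θ)) x)) =
      -sphInner (sphHarm l m) (sphHarm l' m') := by
    rw [sphInner, sphInner, ← integral_neg]
    congr 1
    funext x
    simp only [sphHarm_eq, azim_rotZ, rotZ_two, hζ, map_mul]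
    linear_combination (conj (harmConst l m : ℂ) * conj (azim m x) *
      conj (((Polynomial.derivative^[m.natAbs] (legendre l)).eval (x.1 2) : ℝ) : ℂ) *
      (harmConst l' m' * azim m' x *
      ((Polynomial.derivative^[m'.natAbs] (legendre l')).eval (x.1 2) : ℝ))) * he
  rw [h2] at h
  linear_combination (-1 / 2 : ℂ) * h

/-- For equal orders the azimuthal factors combine to `(1 - x₂²)^|m|`, so the integrand is a
polynomial in `x₂` alone. -/
theorem sphInner_sphHarm_same (l l' : ℕ) {m : ℤ} (hm : m.natAbs ≤ l) :
    sphInner (sphHarm l m) (sphHarm l' m) = if l = l' then 1 else 0 := by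
  have h1 : sphInner (sphHarm l m) (sphHarm l' m) =
      ((∫ x : S2, harmConst l m * harmConst l' m *
        ((1 - Polynomial.X ^ 2) ^ m.natAbs * Polynomial.derivative^[m.natAbs] (legendre l) *
          Polynomial.derivative^[m.natAbs] (legendre l')).eval (x.1 2) ∂surf : ℝ) : ℂ) := by
    rw [sphInner, ← integral_complex_ofReal]
    congr 1
    funext x
    simp only [sphHarm_eq, map_mul, Complex.conj_ofReal, Polynomial.eval_mul, Polynomial.eval_pow,
      Polynomial.eval_sub, Polynomial.eval_one, Polynomial.eval_X]
    push_cast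
    rw [← conj_azim_mul_azim]
    ring
  rw [h1, integral_const_mul, integral_polynomial_coord]
  change ((_ * (_ * polyInt _) : ℝ) : ℂ) = _
  rw [polyInt_assoc_mul_assoc hm]
  split_ifs with h
  · subst h
    rw [← pow_two, harmConst_sq]
    norm_cast
    have h2 : ((l - m.natAbs).factorial : ℝ) ≠ 0 := by positivity
    have h3 : ((l + m.natAbs).factorial : ℝ) ≠ 0 := by positivity
    have h4 : (2 * (l : ℝ) + 1) ≠ 0 := by positivity
    have := Real.pi_pos.ne'
    push_cast
    field_simp
    norm_num
  · simp

theorem sphInner_sphHarm_self {l : ℕ} (m m' : MIdx l) :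
    sphInner (sphHarm l m) (sphHarm l m') = if m = m' then 1 else 0 := by
  split_ifs with h
  · rw [← h, sphInner_sphHarm_same l l m.natAbs_le, if_pos rfl]
  · exact sphInner_sphHarm_of_ne l l fun h' => h (Subtype.ext h')

theorem sphInner_sphHarm_of_degree_ne {l l' : ℕ} (h : l ≠ l') (m : MIdx l) (m' : MIdx l') :
    sphInner (sphHarm l m) (sphHarm l' m') = 0 := by
  by_cases hm : m.1 = m'.1
  · rw [← hm, sphInner_sphHarm_same l l' m.natAbs_le, if_neg h]
  · exact sphInner_sphHarm_of_ne l l' hm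

/-! ### Polynomial functions on the sphere -/

/-- The coordinate functions, with complex values. -/
noncomputable def coordFun (i : Fin 3) : S2 → ℂ := fun x => (x.1 i : ℂ)

/-- Affine functions on the sphere. -/
noncomputable def affineFun : Submodule ℂ (S2 → ℂ) :=
  Submodule.span ℂ (insert 1 (Set.range coordFun))

theorem one_mem_affineFun : (1 : S2 → ℂ) ∈ affineFun :=
  Submodule.subset_span (Set.mem_insert _ _)

theorem coordFun_mem_affineFun (i : Fin 3) : coordFun i ∈ affineFun :=
  Submodule.subset_span (Set.mem_insert_of_mem _ ⟨i, rfl⟩)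

/-- Because constants are affine, `affineFun ^ L` is the space of all polynomial functions of degree
at most `L`. -/
theorem affineFun_pow_mono {a b : ℕ} (h : a ≤ b) : affineFun ^ a ≤ affineFun ^ b :=
  pow_le_pow_right' (Submodule.one_le.2 one_mem_affineFun) h

/-- Composition with a rotation, as an algebra homomorphism. -/
noncomputable def compRotate (g : SO3) : (S2 → ℂ) →ₐ[ℂ] (S2 → ℂ) where
  toFun f x := f (rotate g x)
  map_one' := rfl
  map_mul' _ _ := rfl
  map_zero' := rfl
  map_add' _ _ := rfl
  commutes' _ := rfl

theorem map_compRotate_affineFun (g : SO3) :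
    affineFun.map (compRotate g).toLinearMap ≤ affineFun := by
  rw [affineFun, Submodule.map_span, Submodule.span_le]
  rintro _ ⟨f, rfl | ⟨i, rfl⟩, rfl⟩
  · exact one_mem_affineFun
  · have h : (compRotate g).toLinearMap (coordFun i) = ∑ j, (g.1 i j : ℂ) • coordFun j := by
      funext x
      change ((rotate g x).1 i : ℂ) = _
      rw [rotate_apply]
      simp [coordFun]
    rw [h]
    exact Submodule.sum_mem _ fun j _ => Submodule.smul_mem _ _ (coordFun_mem_affineFun j)

theorem comp_rotate_mem_affineFun_pow (g : SO3) {L : ℕ} {f : S2 → ℂ} (hf : f ∈ affineFun ^ L) :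
    (fun x => f (rotate g x)) ∈ affineFun ^ L := by
  have h : (compRotate g).toLinearMap f ∈ (affineFun ^ L).map (compRotate g).toLinearMap :=
    Submodule.mem_map_of_mem hf
  rw [Submodule.map_pow] at h
  exact pow_le_pow_left' (map_compRotate_affineFun g) L h

theorem planar_mem : planar ∈ affineFun := by
  have h : planar = coordFun 0 + Complex.I • coordFun 1 := by
    funext x; simp [planar_eq, coordFun, mul_comm]
  rw [h]
  exact add_mem (coordFun_mem_affineFun 0) (Submodule.smul_mem _ _ (coordFun_mem_affineFun 1))

theorem conj_planar_mem : (fun x => conj (planar x)) ∈ affineFun := by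
  have h : (fun x => conj (planar x)) = coordFun 0 - Complex.I • coordFun 1 := by
    funext x; simp [conj_planar_eq, coordFun, mul_comm]
  rw [h]
  exact sub_mem (coordFun_mem_affineFun 0) (Submodule.smul_mem _ _ (coordFun_mem_affineFun 1))

theorem azim_mem (m : ℤ) : azim m ∈ affineFun ^ m.natAbs := by
  rcases m with k | k
  · exact Submodule.pow_mem_pow _ planar_mem k
  · exact Submodule.pow_mem_pow _ conj_planar_mem (k + 1)

theorem polynomial_coord_mem (p : Polynomial ℝ) {d : ℕ} (hd : p.natDegree ≤ d) :
    (fun x : S2 => ((p.eval (x.1 2) : ℝ) : ℂ)) ∈ affineFun ^ d := by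
  have h : (fun x : S2 => ((p.eval (x.1 2) : ℝ) : ℂ)) =
      ∑ i ∈ Finset.range (d + 1), (p.coeff i : ℂ) • coordFun 2 ^ i := by
    funext x
    rw [Polynomial.eval_eq_sum_range' (Nat.lt_succ_of_le hd)]
    simp [coordFun]
  rw [h]
  refine Submodule.sum_mem _ fun i hi => Submodule.smul_mem _ _ ?_
  exact affineFun_pow_mono (Nat.lt_succ_iff.1 (Finset.mem_range.1 hi))
    (Submodule.pow_mem_pow _ (coordFun_mem_affineFun 2) i)

theorem sphHarm_mem {l : ℕ} (m : MIdx l) : sphHarm l m ∈ affineFun ^ l := by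
  have h : sphHarm l m = (harmConst l m : ℂ) • (azim m * fun x : S2 =>
      (((Polynomial.derivative^[m.1.natAbs] (legendre l)).eval (x.1 2) : ℝ) : ℂ)) := by
    funext x
    rw [sphHarm_eq]
    simp [mul_assoc]
  rw [h]
  apply Submodule.smul_mem
  have hl : l = m.1.natAbs + (l - m.1.natAbs) := by have := m.natAbs_le; omega
  rw [show affineFun ^ l = affineFun ^ m.1.natAbs * affineFun ^ (l - m.1.natAbs) by
    rw [← pow_add, ← hl]]
  exact Submodule.mul_mem_mul (azim_mem m)
    (polynomial_coord_mem _ (natDegree_iterate_derivative_legendre_le l _))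

/-- The span of the functions `azim m * x₂ᵏ` with `|m| + k ≤ L`. -/
noncomputable def azimSpan (L : ℕ) : Submodule ℂ (S2 → ℂ) :=
  Submodule.span ℂ {f | ∃ (m : ℤ) (k : ℕ), m.natAbs + k ≤ L ∧ f = azim m * coordFun 2 ^ k}

theorem azim_mul_mem {m : ℤ} {k L : ℕ} (h : m.natAbs + k ≤ L) :
    azim m * coordFun 2 ^ k ∈ azimSpan L :=
  Submodule.subset_span ⟨m, k, h, rfl⟩

theorem planar_mul_mem {m : ℤ} {k L : ℕ} (h : m.natAbs + k ≤ L) :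
    planar * (azim m * coordFun 2 ^ k) ∈ azimSpan (L + 1) := by
  rcases le_or_gt 0 m with hm | hm
  · have h1 : planar * (azim m * coordFun 2 ^ k) = azim (m + 1) * coordFun 2 ^ k := by
      funext x
      simp only [Pi.mul_apply]
      rw [← mul_assoc, planar_mul_azim_of_nonneg hm]
    rw [h1]
    exact azim_mul_mem (by omega)
  -- Here `|m + 1| = |m| - 1`, which leaves room for the two extra powers of `x₂`.
  · have h1 : planar * (azim m * coordFun 2 ^ k) =
        azim (m + 1) * coordFun 2 ^ k - azim (m + 1) * coordFun 2 ^ (k + 2) := by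
      funext x
      simp only [Pi.mul_apply, Pi.sub_apply, Pi.pow_apply]
      rw [← mul_assoc, planar_mul_azim_of_neg hm, coordFun]
      ring
    rw [h1]
    exact sub_mem (azim_mul_mem (by omega)) (azim_mul_mem (by omega))

theorem conj_mem_azimSpan {L : ℕ} {f : S2 → ℂ} (hf : f ∈ azimSpan L) : star f ∈ azimSpan L := by
  induction hf using Submodule.span_induction with
  | mem f hf =>
    obtain ⟨m, k, h, rfl⟩ := hf
    have h1 : star (azim m * coordFun 2 ^ k) = azim (-m) * coordFun 2 ^ k := by
      funext x
      simp [← conj_azim, coordFun, mul_comm]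
    rw [h1]
    exact azim_mul_mem (by omega)
  | zero => simp
  | add f h _ _ hf hh => rw [star_add]; exact add_mem hf hh
  | smul c f _ hf => rw [star_smul]; exact Submodule.smul_mem _ _ hf

theorem conj_planar_mul_mem {m : ℤ} {k L : ℕ} (h : m.natAbs + k ≤ L) :
    star planar * (azim m * coordFun 2 ^ k) ∈ azimSpan (L + 1) := by
  have h1 : star planar * (azim m * coordFun 2 ^ k) =
      star (planar * (azim (-m) * coordFun 2 ^ k)) := by
    funext x
    simp [← conj_azim, coordFun]
  rw [h1]
  exact conj_mem_azimSpan (planar_mul_mem (by omega))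

/-- Coordinates are combinations of `x₀ ± i x₁` and `x₂`, and multiplication by each of these raises
the bound on `|m| + k` by at most one. -/
theorem affineFun_pow_le_azimSpan (L : ℕ) : affineFun ^ L ≤ azimSpan L := by
  induction L with
  | zero =>
    rw [pow_zero, Submodule.one_le]
    have h := azim_mul_mem (m := 0) (k := 0) (L := 0) (by simp)
    have h1 : azim 0 * coordFun 2 ^ 0 = 1 := by
      funext x
      change planar x ^ 0 * _ = 1
      simp
    rwa [h1] at h
  | succ L ih =>
    rw [pow_succ']
    refine (mul_le_mul' le_rfl ih).trans ?_
    rw [affineFun, azimSpan, Submodule.span_mul_span, Submodule.span_le]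
    rintro _ ⟨f, hf, _, ⟨m, k, h, rfl⟩, rfl⟩
    change f * _ ∈ azimSpan (L + 1)
    have hu := planar_mul_mem h
    have hv := conj_planar_mul_mem h
    rcases hf with rfl | ⟨i, rfl⟩
    · rw [one_mul]
      exact azim_mul_mem (by omega)
    · fin_cases i
      · change coordFun 0 * _ ∈ _
        have h0 : coordFun 0 = (1 / 2 : ℂ) • (planar + star planar) := by
          funext x
          simp [planar_eq, coordFun]
          ring
        rw [h0, smul_mul_assoc, add_mul]
        exact Submodule.smul_mem _ _ (add_mem hu hv)
      · change coordFun 1 * _ ∈ _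
        have h0 : coordFun 1 = (-Complex.I / 2 : ℂ) • (planar - star planar) := by
          funext x
          simp [planar_eq, coordFun]
          linear_combination (x.1 1 : ℂ) * Complex.I_sq
        rw [h0, smul_mul_assoc, sub_mul]
        exact Submodule.smul_mem _ _ (sub_mem hu hv)
      · change coordFun 2 * _ ∈ _
        have h0 : coordFun 2 * (azim m * coordFun 2 ^ k) = azim m * coordFun 2 ^ (k + 1) := by
          ring
        rw [h0]
        exact azim_mul_mem (by omega)

/-- The span of the spherical harmonics of degree at most `L`. -/
noncomputable def harmSpan (L : ℕ) : Submodule ℂ (S2 → ℂ) :=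
  Submodule.span ℂ {f | ∃ l ≤ L, ∃ m : MIdx l, f = sphHarm l m}

/-- Triangular elimination. The polynomial factor of `Y_{|m|+d, m}` has degree exactly `d`, so
subtracting a multiple of this harmonic lowers the degree of `p`. -/
theorem azim_mul_polynomial_mem (m : ℤ) (L d : ℕ) (hL : m.natAbs + d ≤ L + 1) (p : Polynomial ℝ)
    (hp : p.degree < d) :
    (azim m * fun x : S2 => ((p.eval (x.1 2) : ℝ) : ℂ)) ∈ harmSpan L := by
  induction d generalizing p with
  | zero =>
    have h0 : p = 0 := by
      rw [← Polynomial.degree_eq_bot]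
      simpa using hp
    have h1 : (azim m * fun x : S2 => ((p.eval (x.1 2) : ℝ) : ℂ)) = 0 := by
      funext x
      simp [h0]
    rw [h1]
    exact zero_mem _
  | succ d ih =>
    set q := Polynomial.derivative^[m.natAbs] (legendre (m.natAbs + d)) with hq
    have hq0 : q.coeff d ≠ 0 := by
      have := coeff_iterate_derivative_legendre (m.natAbs + d) m.natAbs (by omega)
      rwa [Nat.add_sub_cancel_left] at this
    have hqd : q.natDegree ≤ d := by
      have := natDegree_iterate_derivative_legendre_le (m.natAbs + d) m.natAbs
      rwa [Nat.add_sub_cancel_left] at this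
    set a := p.coeff d / q.coeff d with ha
    have hr : (p - Polynomial.C a * q).degree < d := by
      rw [Polynomial.degree_lt_iff_coeff_zero]
      intro k hk
      rw [Polynomial.coeff_sub, Polynomial.coeff_C_mul]
      rcases hk.eq_or_lt with rfl | hk
      · rw [ha]; field_simp; ring
      · rw [(Polynomial.degree_lt_iff_coeff_zero _ _).1 hp k (by omega),
          Polynomial.coeff_eq_zero_of_natDegree_lt (by omega)]
        simp
    have hm : (m : ℤ) ∈ Finset.Icc (-((m.natAbs + d : ℕ) : ℤ)) ((m.natAbs + d : ℕ) : ℤ) := by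
      rw [Finset.mem_Icc]; omega
    have hY : sphHarm (m.natAbs + d) m ∈ harmSpan L :=
      Submodule.subset_span ⟨m.natAbs + d, by omega, ⟨m, hm⟩, rfl⟩
    have hc : (harmConst (m.natAbs + d) m : ℂ) ≠ 0 := by
      exact_mod_cast harmConst_ne_zero _ m
    have h1 : (azim m * fun x : S2 => ((p.eval (x.1 2) : ℝ) : ℂ)) =
        (azim m * fun x : S2 => (((p - Polynomial.C a * q).eval (x.1 2) : ℝ) : ℂ)) +
          ((a : ℂ) / harmConst (m.natAbs + d) m) • sphHarm (m.natAbs + d) m := by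
      funext x
      simp only [Pi.mul_apply, Pi.add_apply, Pi.smul_apply, smul_eq_mul, sphHarm_eq, ← hq,
        Polynomial.eval_sub, Polynomial.eval_mul, Polynomial.eval_C]
      push_cast
      field_simp
      ring
    rw [h1]
    exact add_mem (ih (by omega) _ hr) (Submodule.smul_mem _ _ hY)

theorem affineFun_pow_le_harmSpan (L : ℕ) : affineFun ^ L ≤ harmSpan L := by
  refine (affineFun_pow_le_azimSpan L).trans ?_
  rw [azimSpan, Submodule.span_le]
  rintro _ ⟨m, k, h, rfl⟩
  have h1 := azim_mul_polynomial_mem m L (k + 1) (by omega) (Polynomial.X ^ k) (by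
    rw [Polynomial.degree_X_pow]; exact_mod_cast Nat.lt_succ_self k)
  convert! h1 using 2
  funext x
  simp [coordFun]

theorem continuous_of_mem_harmSpan {L : ℕ} {f : S2 → ℂ} (hf : f ∈ harmSpan L) : Continuous f := by
  induction hf using Submodule.span_induction with
  | mem f hf =>
    obtain ⟨l, _, m, rfl⟩ := hf
    exact continuous_sphHarm l m
  | zero => exact continuous_const
  | add f h _ _ hf hh => exact hf.add hh
  | smul c f _ hf => exact hf.const_smul c

theorem sphInner_eq_zero_of_mem_harmSpan {L l : ℕ} (hl : L < l) (m : MIdx l) {f : S2 → ℂ}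
    (hf : f ∈ harmSpan L) : sphInner (sphHarm l m) f = 0 := by
  induction hf using Submodule.span_induction with
  | mem f hf =>
    obtain ⟨l', hl', m', rfl⟩ := hf
    exact sphInner_sphHarm_of_degree_ne (by omega) m m'
  | zero => simp [sphInner]
  | add f h hf' hh' hf hh =>
    rw [sphInner_add_right (continuous_sphHarm l m) (continuous_of_mem_harmSpan hf')
      (continuous_of_mem_harmSpan hh'), hf, hh, add_zero]
  | smul c f _ hf => rw [sphInner_smul_right, hf, mul_zero]

theorem eq_sum_of_mem_harmSpan {L : ℕ} {f : S2 → ℂ} (hf : f ∈ harmSpan L) :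
    f = ∑ l ∈ Finset.range (L + 1), ∑ m : MIdx l, sphInner (sphHarm l m) f • sphHarm l m := by
  induction hf using Submodule.span_induction with
  | mem f hf =>
    obtain ⟨l', hl', m', rfl⟩ := hf
    rw [Finset.sum_eq_single_of_mem l' (Finset.mem_range.2 (by omega)) fun l _ hl =>
      Finset.sum_eq_zero fun m _ => by rw [sphInner_sphHarm_of_degree_ne hl, zero_smul]]
    simp [sphInner_sphHarm_self]
  | zero => simp [sphInner]
  | add f h hf' hh' hf hh =>
    conv_lhs => rw [hf, hh]
    simp only [← Finset.sum_add_distrib]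
    refine Finset.sum_congr rfl fun l _ => Finset.sum_congr rfl fun m _ => ?_
    rw [sphInner_add_right (continuous_sphHarm l m) (continuous_of_mem_harmSpan hf')
      (continuous_of_mem_harmSpan hh'), add_smul]
  | smul c f _ hf =>
    conv_lhs => rw [hf]
    simp only [Finset.smul_sum, sphInner_smul_right, mul_smul]

/-- A rotated harmonic is still a polynomial of degree at most `l`, hence a combination of harmonics
of degree at most `l`. -/
theorem sphHarm_comp_rotate_mem {l : ℕ} (m : MIdx l) (g : SO3) :
    (fun x => sphHarm l m (rotate g x)) ∈ harmSpan l :=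
  affineFun_pow_le_harmSpan l (comp_rotate_mem_affineFun_pow g (sphHarm_mem m))

/-! ### Wigner matrices -/

theorem wignerD_apply (l : ℕ) (g : SO3) (m m' : MIdx l) :
    wignerD l g m m' = sphInner (sphHarm l m) fun x => sphHarm l m' (rotate g⁻¹ x) := rfl

/-- Only degree `l` survives in the expansion: against `Y_{l'm}` with `l' < l` the rotation can be
moved to that factor, which stays in degrees at most `l'` and so remains orthogonal to `Y_{lm'}`. -/
theorem sphHarm_rotate_inv {l : ℕ} (g : SO3) (m' : MIdx l) (x : S2) :
    sphHarm l m' (rotate g⁻¹ x) = ∑ m, wignerD l g m m' * sphHarm l m x := by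
  have h := eq_sum_of_mem_harmSpan (sphHarm_comp_rotate_mem m' g⁻¹)
  rw [Finset.sum_range_succ, Finset.sum_eq_zero, zero_add] at h
  · have h' := congrFun h x
    simpa [wignerD_apply] using h'
  · intro l' hl'
    refine Finset.sum_eq_zero fun m _ => ?_
    have h0 : sphInner (sphHarm l' m) (fun x => sphHarm l m' (rotate g⁻¹ x)) = 0 := by
      rw [← sphInner_rotate g]
      simp only [rotate_inv_rotate]
      rw [← sphInner_conj_symm, sphInner_eq_zero_of_mem_harmSpan (Finset.mem_range.1 hl') m'
        (sphHarm_comp_rotate_mem m g), map_zero]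
    rw [h0, zero_smul]

theorem wignerD_inv (l : ℕ) (g : SO3) (m m' : MIdx l) :
    wignerD l g⁻¹ m m' = conj (wignerD l g m' m) := by
  rw [wignerD_apply, wignerD_apply, sphInner_conj_symm, ← sphInner_rotate g⁻¹, inv_inv]
  simp only [rotate_rotate_inv]

/-- Unitarity turns the conjugated matrix of `g⁻¹` into `D^l(g)`; this is the form that acts on
coefficients. -/
theorem conj_sphHarm_rotate {l : ℕ} (g : SO3) (m : MIdx l) (x : S2) :
    conj (sphHarm l m (rotate g x)) = ∑ m', wignerD l g m m' * conj (sphHarm l m' x) := by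
  have h := sphHarm_rotate_inv g⁻¹ m x
  rw [inv_inv] at h
  rw [h, map_sum]
  refine Finset.sum_congr rfl fun m' _ => ?_
  rw [map_mul, wignerD_inv, Complex.conj_conj]

theorem sphInner_sum_right {ι : Type*} (s : Finset ι) {f : S2 → ℂ} (hf : Continuous f)
    (c : ι → ℂ) {h : ι → S2 → ℂ} (hh : ∀ i, Continuous (h i)) :
    sphInner f (fun x => ∑ i ∈ s, c i * h i x) = ∑ i ∈ s, c i * sphInner f (h i) := by
  simp only [sphInner, Finset.mul_sum]
  rw [integral_finsetSum]
  · refine Finset.sum_congr rfl fun i _ => ?_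
    rw [← integral_const_mul]
    congr 1
    funext x
    ring
  · intro i _
    exact integrable_conj_mul hf (continuous_const.mul (hh i))

theorem wignerD_mul (l : ℕ) (g h : SO3) : wignerD l (g * h) = wignerD l g * wignerD l h := by
  ext m m'
  rw [Matrix.mul_apply, wignerD_apply]
  simp only [mul_inv_rev, rotate_mul, sphHarm_rotate_inv h]
  rw [sphInner_sum_right _ (continuous_sphHarm l m) (fun k => wignerD l h k m')
    (h := fun (k : MIdx l) x => sphHarm l k (rotate g⁻¹ x))
    fun k => (continuous_sphHarm l k).comp (continuous_rotate _)]
  refine Finset.sum_congr rfl fun k _ => ?_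
  rw [mul_comm, wignerD_apply l g]

instance : SecondCountableTopology SO3 := by
  have : SecondCountableTopology (Matrix (Fin 3) (Fin 3) ℝ) :=
    inferInstanceAs (SecondCountableTopology (Fin 3 → Fin 3 → ℝ))
  exact TopologicalSpace.Subtype.secondCountableTopology
    (Matrix.specialOrthogonalGroup (Fin 3) ℝ : Set (Matrix (Fin 3) (Fin 3) ℝ))

theorem continuous_wignerD (l : ℕ) (m m' : MIdx l) : Continuous fun g => wignerD l g m m' := by
  simp only [wignerD_apply, sphInner]
  have h := continuous_parametric_integral_of_continuous (s := Set.univ) (μ := surf)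
    (f := fun (g : SO3) (x : S2) => conj (sphHarm l m x) * sphHarm l m' (rotate g⁻¹ x)) ?_
    isCompact_univ
  · simpa using h
  · refine Continuous.mul
      (Complex.continuous_conj.comp ((continuous_sphHarm l m).comp continuous_snd)) ?_
    exact (continuous_sphHarm l m').comp (continuous_rotate_uncurry.comp
      ((continuous_inv.comp continuous_fst).prodMk continuous_snd))

/-! ### The matrices `Δ` -/

theorem DeltaAt_mul {n : ℕ} (l : Fin n → ℕ) (g h : SO3) :
    DeltaAt l (g * h) = DeltaAt l g * DeltaAt l h := by
  ext m m'
  rw [Matrix.mul_apply]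
  simp only [DeltaAt, Matrix.of_apply, wignerD_mul, Matrix.mul_apply]
  rw [Finset.prod_univ_sum]
  simp only [Fintype.piFinset_univ, Finset.prod_mul_distrib]

theorem continuous_DeltaAt {n : ℕ} (l : Fin n → ℕ) (m m' : KIdx l) :
    Continuous fun g => DeltaAt l g m m' := by
  simp only [DeltaAt, Matrix.of_apply]
  exact continuous_finsetProd _ fun i _ => continuous_wignerD _ _ _

instance : IsProbabilityMeasure haarSO3 where
  measure_univ := by
    have h := Measure.haarMeasure_self (K₀ := (⊤ : TopologicalSpace.PositiveCompacts SO3))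
    simpa [haarSO3] using h

instance : haarSO3.IsMulLeftInvariant :=
  inferInstanceAs (Measure.haarMeasure _).IsMulLeftInvariant

theorem integrable_DeltaAt {n : ℕ} (l : Fin n → ℕ) (m m' : KIdx l) :
    Integrable (fun g => DeltaAt l g m m') haarSO3 :=
  (continuous_DeltaAt l m m').integrable_of_hasCompactSupport (HasCompactSupport.of_compactSpace _)

/-- Left invariance of Haar measure absorbs `g`, so the range of `Δ` consists of vectors fixed by
every `Δ(g)`. -/
theorem DeltaAt_mul_Delta {n : ℕ} (l : Fin n → ℕ) (g : SO3) :
    DeltaAt l g * Delta l = Delta l := by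
  ext m m'
  rw [Matrix.mul_apply]
  simp only [Delta, Matrix.of_apply]
  rw [← integral_mul_left_eq_self (fun h => DeltaAt l h m m') g]
  simp only [DeltaAt_mul, Matrix.mul_apply, ← integral_const_mul]
  rw [integral_finsetSum]
  exact fun k _ => (integrable_DeltaAt l k m').const_mul _

theorem Delta_mulVec_of_forall {n : ℕ} (l : Fin n → ℕ) (v : KIdx l → ℂ)
    (h : ∀ g, (DeltaAt l g).mulVec v = v) : (Delta l).mulVec v = v := by
  funext m
  have h1 : (Delta l).mulVec v m = ∫ g, (DeltaAt l g).mulVec v m ∂haarSO3 := by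
    simp only [Matrix.mulVec, dotProduct, Delta, Matrix.of_apply, ← integral_mul_const]
    rw [integral_finsetSum]
    exact fun k _ => (integrable_DeltaAt l m k).mul_const _
  rw [h1]
  simp [h]

theorem DeltaAt_mulVec_of_Delta {n : ℕ} (l : Fin n → ℕ) (v : KIdx l → ℂ)
    (h : (Delta l).mulVec v = v) (g : SO3) : (DeltaAt l g).mulVec v = v := by
  conv_lhs => rw [← h]
  rw [Matrix.mulVec_mulVec, DeltaAt_mul_Delta, h]

theorem DeltaAt_mulVec_kronVec {n : ℕ} (l : Fin n → ℕ) (g : SO3)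
    (v : (i : Fin n) → MIdx (l i) → ℂ) :
    (DeltaAt l g).mulVec (kronVec l v) = kronVec l fun i => (wignerD (l i) g).mulVec (v i) := by
  funext m
  simp only [Matrix.mulVec, dotProduct, kronVec, DeltaAt, Matrix.of_apply]
  rw [Finset.prod_univ_sum]
  simp only [Fintype.piFinset_univ, Finset.prod_mul_distrib]

/-! ### Moments of the field and of its harmonic coefficients -/

section Moments

variable {Ω : Type*} [MeasurableSpace Ω] {P : Measure Ω} {T : S2 → Ω → ℝ} {n : ℕ}

/-- The product is at most the `n`-th power of its largest factor. Only finiteness matters, so this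
replaces Hölder. -/
theorem prod_le_sum_pow (hn : n ≠ 0) (a : Fin n → ENNReal) :
    ∏ i, a i ≤ ∑ i, a i ^ n := by
  have : Nonempty (Fin n) := ⟨⟨0, Nat.pos_of_ne_zero hn⟩⟩
  obtain ⟨i₀, h⟩ := Finite.exists_max a
  calc ∏ i, a i ≤ ∏ _i : Fin n, a i₀ := Finset.prod_le_prod' fun i _ => h i
    _ = a i₀ ^ n := by simp
    _ ≤ ∑ i, a i ^ n :=
        Finset.single_le_sum (f := fun i => a i ^ n) (fun _ _ => zero_le) (Finset.mem_univ i₀)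

/-- The `n`-point moment `E[T(x₁) ⋯ T(xₙ)]`. -/
noncomputable def pointMoment (P : Measure Ω) (T : S2 → Ω → ℝ) {n : ℕ} (x : Fin n → S2) : ℝ :=
  ∫ ω, ∏ i, T (x i) ω ∂P

/-- The product surface measure on `(S²)ⁿ`. -/
noncomputable abbrev surfPi (n : ℕ) : Measure (Fin n → S2) := Measure.pi fun _ => surf

theorem measurable_section (hT : Measurable (Function.uncurry T)) (x : S2) : Measurable (T x) :=
  hT.comp measurable_prodMk_left

theorem lintegral_pow_le_supMoment (x : S2) : ∫⁻ ω, ‖T x ω‖ₑ ^ n ∂P ≤ supMoment P T n :=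
  le_iSup (fun x => ∫⁻ ω, ‖T x ω‖ₑ ^ n ∂P) x

theorem memLp_of_supMoment (hn : n ≠ 0) (hT : Measurable (Function.uncurry T))
    (hS : supMoment P T n < ⊤) (x : S2) : MemLp (T x) n P := by
  refine ⟨(measurable_section hT x).aestronglyMeasurable, ?_⟩
  rw [eLpNorm_lt_top_iff_lintegral_rpow_enorm_lt_top (by exact_mod_cast hn) (by simp)]
  simp only [ENNReal.toReal_natCast, ENNReal.rpow_natCast]
  exact (lintegral_pow_le_supMoment x).trans_lt hS

theorem lintegral_prod_le (hn : n ≠ 0) (hT : Measurable (Function.uncurry T)) (x : Fin n → S2) :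
    ∫⁻ ω, ∏ i, ‖T (x i) ω‖ₑ ∂P ≤ n * supMoment P T n := by
  calc ∫⁻ ω, ∏ i, ‖T (x i) ω‖ₑ ∂P ≤ ∫⁻ ω, ∑ i, ‖T (x i) ω‖ₑ ^ n ∂P :=
        lintegral_mono fun ω => prod_le_sum_pow hn _
    _ = ∑ i, ∫⁻ ω, ‖T (x i) ω‖ₑ ^ n ∂P :=
        lintegral_finsetSum _ fun i _ => ((measurable_section hT _).enorm.pow_const n)
    _ ≤ ∑ _i : Fin n, supMoment P T n := Finset.sum_le_sum fun i _ => lintegral_pow_le_supMoment _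
    _ = n * supMoment P T n := by simp

theorem measurable_prod_field (hT : Measurable (Function.uncurry T)) :
    Measurable fun p : Ω × (Fin n → S2) => ∏ i, T (p.2 i) p.1 := by
  refine Finset.measurable_prod _ fun i _ => ?_
  have h : Measurable fun p : Ω × (Fin n → S2) => (p.2 i, p.1) := by fun_prop
  exact hT.comp h

theorem integrable_prod_field [SFinite P] (hn : n ≠ 0) (hT : Measurable (Function.uncurry T))
    (hS : supMoment P T n < ⊤) :
    Integrable (fun p : Ω × (Fin n → S2) => ∏ i, T (p.2 i) p.1) (P.prod (surfPi n)) := by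
  refine ⟨(measurable_prod_field hT).aestronglyMeasurable, ?_⟩
  rw [HasFiniteIntegral, lintegral_prod_symm _ (measurable_prod_field hT).enorm.aemeasurable]
  calc ∫⁻ x : Fin n → S2, ∫⁻ ω, ‖∏ i, T (x i) ω‖ₑ ∂P ∂surfPi n
      ≤ ∫⁻ _x : Fin n → S2, n * supMoment P T n ∂surfPi n := by
        refine lintegral_mono fun x => ?_
        refine le_trans (le_of_eq ?_) (lintegral_prod_le hn hT x)
        congr 1
        funext ω
        simp only [enorm_eq_nnnorm, nnnorm_prod]
        push_cast
        rfl
    _ < ⊤ := by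
        rw [lintegral_const]
        exact ENNReal.mul_lt_top (ENNReal.mul_lt_top (by simp) hS) (measure_lt_top _ _)

theorem integrable_pointMoment [SFinite P] (hn : n ≠ 0) (hT : Measurable (Function.uncurry T))
    (hS : supMoment P T n < ⊤) : Integrable (fun x => pointMoment P T x) (surfPi n) :=
  (integrable_prod_field hn hT hS).integral_prod_right

/-- The function `conj (Y_{l₁m₁}(x₁) ⋯ Y_{lₙmₙ}(xₙ))`. -/
noncomputable def conjHarmProd {n : ℕ} (l : Fin n → ℕ) (m : KIdx l) (x : Fin n → S2) : ℂ :=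
  ∏ i, conj (sphHarm (l i) (m i) (x i))

theorem continuous_conjHarmProd (l : Fin n → ℕ) (m : KIdx l) : Continuous (conjHarmProd l m) :=
  continuous_finsetProd _ fun i _ => Complex.continuous_conj.comp
    ((continuous_sphHarm _ _).comp (continuous_apply i))

theorem exists_norm_conjHarmProd_le (l : Fin n → ℕ) (m : KIdx l) :
    ∃ C, ∀ x, ‖conjHarmProd l m x‖ ≤ C := by
  obtain ⟨C, hC⟩ := isCompact_univ.exists_bound_of_continuousOn
    (continuous_conjHarmProd l m).continuousOn
  exact ⟨C, fun x => hC x (Set.mem_univ x)⟩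

theorem integrable_prod_field_mul [SFinite P] (hn : n ≠ 0)
    (hT : Measurable (Function.uncurry T)) (hS : supMoment P T n < ⊤) (l : Fin n → ℕ)
    (m : KIdx l) :
    Integrable (fun p : Ω × (Fin n → S2) => ((∏ i, T (p.2 i) p.1 : ℝ) : ℂ) * conjHarmProd l m p.2)
      (P.prod (surfPi n)) := by
  obtain ⟨C, hC⟩ := exists_norm_conjHarmProd_le l m
  exact (integrable_prod_field hn hT hS).ofReal.mul_bdd (c := C)
    ((continuous_conjHarmProd l m).measurable.comp measurable_snd).aestronglyMeasurable
    (Filter.Eventually.of_forall fun p => hC p.2)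

/-- A product of integrals is one integral over the product space, for every `ω`, integrable
trajectory or not. -/
theorem kronVec_coeff_eq {Ω : Type*} {T : S2 → Ω → ℝ} (l : Fin n → ℕ) (m : KIdx l) (ω : Ω) :
    kronVec l (fun i => coeff T (l i) ω) m =
      ∫ x, ((∏ i, T (x i) ω : ℝ) : ℂ) * conjHarmProd l m x ∂surfPi n := by
  simp only [kronVec, coeff]
  rw [← integral_fintype_prod_eq_prod (fun i x => (T x ω : ℂ) * conj (sphHarm (l i) (m i) x))]
  congr 1
  funext x
  rw [conjHarmProd, Finset.prod_mul_distrib]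
  push_cast
  rfl

theorem integrable_kronVec_coeff [SFinite P] (hn : n ≠ 0)
    (hT : Measurable (Function.uncurry T)) (hS : supMoment P T n < ⊤) (l : Fin n → ℕ)
    (m : KIdx l) : Integrable (fun ω => kronVec l (fun i => coeff T (l i) ω) m) P := by
  simp only [kronVec_coeff_eq]
  exact (integrable_prod_field_mul hn hT hS l m).integral_prod_left

/-- Fubini: the polyspectrum depends on the law of `T` only through the `n`-point moment, whose
harmonic coefficients it lists. -/
theorem polyspectrum_eq [SFinite P] (hn : n ≠ 0) (hT : Measurable (Function.uncurry T))
    (hS : supMoment P T n < ⊤) (l : Fin n → ℕ) (m : KIdx l) :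
    polyspectrum P T l m =
      ∫ x, (pointMoment P T x : ℂ) * conjHarmProd l m x ∂surfPi n := by
  rw [polyspectrum]
  simp only [kronVec_coeff_eq]
  rw [integral_integral_swap (integrable_prod_field_mul hn hT hS l m)]
  congr 1
  funext x
  rw [integral_mul_const, integral_complex_ofReal, pointMoment]

theorem measurable_coeff (hT : Measurable (Function.uncurry T)) (l : ℕ) (m : MIdx l) :
    StronglyMeasurable fun ω => coeff T l ω m := by
  refine StronglyMeasurable.integral_prod_left (μ := surf)
    (f := fun (x : S2) (ω : Ω) => (T x ω : ℂ) * conj (sphHarm l m x)) ?_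
  refine Measurable.stronglyMeasurable ?_
  exact (Complex.measurable_ofReal.comp hT).mul
    ((Complex.continuous_conj.comp (continuous_sphHarm l m)).measurable.comp measurable_fst)

theorem finiteSpectralMoments_of_supMoment [SFinite P] (hn : n ≠ 0)
    (hT : Measurable (Function.uncurry T)) (hS : supMoment P T n < ⊤) :
    FiniteSpectralMoments P T n := by
  intro l m
  -- With all degrees and orders equal, the Kronecker entry is `a_{lm}^n`.
  have h := (integrable_kronVec_coeff hn hT hS (fun _ => l) (fun _ => m)).norm
  rw [← integrable_norm_rpow_iff (measurable_coeff hT l m).aestronglyMeasurable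
    (by exact_mod_cast hn) (by simp)]
  simpa [kronVec] using h

theorem ae_memLp_two [IsProbabilityMeasure P] (hn : 2 ≤ n) (hT : Measurable (Function.uncurry T))
    (hS : supMoment P T n < ⊤) : ∀ᵐ ω ∂P, MemLp (fun x => T x ω) 2 surf := by
  have hm : Measurable fun p : Ω × S2 => ‖T p.2 p.1‖ₑ ^ 2 :=
    (hT.comp measurable_swap).enorm.pow_const 2
  have hfin : ∫⁻ ω, ∫⁻ x, ‖T x ω‖ₑ ^ 2 ∂surf ∂P ≠ ⊤ := by
    rw [lintegral_lintegral_swap hm.aemeasurable]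
    refine ne_of_lt ?_
    calc ∫⁻ x, ∫⁻ ω, ‖T x ω‖ₑ ^ 2 ∂P ∂surf ≤ ∫⁻ _x : S2, (1 + supMoment P T n) ∂surf := by
          refine lintegral_mono fun x => ?_
          -- Since `n ≥ 2`, `t² ≤ 1 + tⁿ` for `t ≥ 0`.
          calc ∫⁻ ω, ‖T x ω‖ₑ ^ 2 ∂P ≤ ∫⁻ ω, (1 + ‖T x ω‖ₑ ^ n) ∂P := by
                refine lintegral_mono fun ω => ?_
                rcases le_total ‖T x ω‖ₑ 1 with h | h
                · exact (pow_le_one' h 2).trans le_self_add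
                · exact (pow_le_pow_right' h hn).trans le_add_self
            _ = 1 + ∫⁻ ω, ‖T x ω‖ₑ ^ n ∂P := by
                rw [lintegral_add_left measurable_const]; simp
            _ ≤ 1 + supMoment P T n := by gcongr; exact lintegral_pow_le_supMoment x
      _ < ⊤ := by
          rw [lintegral_const]
          exact ENNReal.mul_lt_top (ENNReal.add_lt_top.2 ⟨by simp, hS⟩) (measure_lt_top _ _)
  filter_upwards [ae_lt_top hm.lintegral_prod_right' hfin] with ω hω
  refine ⟨(hT.comp measurable_prodMk_right).aestronglyMeasurable, ?_⟩
  rw [eLpNorm_lt_top_iff_lintegral_rpow_enorm_lt_top (by simp) (by simp)]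
  simpa using hω

/-! ### Rotated fields -/

theorem measurable_rotated (hT : Measurable (Function.uncurry T)) (g : SO3) :
    Measurable (Function.uncurry fun x => T (rotate g x)) :=
  hT.comp (((continuous_rotate g).measurable.comp measurable_fst).prodMk measurable_snd)

theorem supMoment_rotated_le (g : SO3) :
    supMoment P (fun x => T (rotate g x)) n ≤ supMoment P T n :=
  iSup_le fun x => lintegral_pow_le_supMoment (rotate g x)

/-- Change variables to move the rotation onto the harmonic, then expand it. Integrability of the
trajectory allows the finite sum to leave the integral. -/
theorem wignerD_mulVec_coeff {Ω : Type*} {T : S2 → Ω → ℝ} {ω : Ω}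
    (hω : Integrable (fun x => T x ω) surf) (l : ℕ) (g : SO3) :
    (wignerD l g).mulVec (coeff T l ω) = coeff (fun x => T (rotate g⁻¹ x)) l ω := by
  funext m
  have h1 : coeff (fun x => T (rotate g⁻¹ x)) l ω m =
      ∫ x, (T x ω : ℂ) * conj (sphHarm l m (rotate g x)) ∂surf := by
    rw [← integral_rotate g⁻¹]
    simp only [rotate_rotate_inv]
    rfl
  rw [h1]
  simp only [conj_sphHarm_rotate, Finset.mul_sum, Matrix.mulVec, dotProduct, coeff]
  rw [integral_finsetSum]
  · refine Finset.sum_congr rfl fun m' _ => ?_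
    rw [← integral_const_mul]
    congr 1
    funext x
    ring
  · intro m' _
    have hc : Continuous fun x => wignerD l g m m' * conj (sphHarm l m' x) :=
      continuous_const.mul (Complex.continuous_conj.comp (continuous_sphHarm l m'))
    obtain ⟨C, hC⟩ := isCompact_univ.exists_bound_of_continuousOn hc.continuousOn
    exact hω.ofReal.mul_bdd (c := C) hc.aestronglyMeasurable
      (Filter.Eventually.of_forall fun x => hC x (Set.mem_univ x))

theorem ae_integrable_field [IsProbabilityMeasure P] (hn : 2 ≤ n)
    (hT : Measurable (Function.uncurry T)) (hS : supMoment P T n < ⊤) :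
    ∀ᵐ ω ∂P, Integrable (fun x => T x ω) surf := by
  filter_upwards [ae_memLp_two hn hT hS] with ω hω
  exact hω.integrable (by norm_num)

theorem rotatedPolyspectrum_eq_polyspectrum [IsProbabilityMeasure P] (hn : 2 ≤ n)
    (hT : Measurable (Function.uncurry T)) (hS : supMoment P T n < ⊤) (l : Fin n → ℕ) (g : SO3) :
    rotatedPolyspectrum P T l g = polyspectrum P (fun x => T (rotate g⁻¹ x)) l := by
  funext m
  refine integral_congr_ae ?_
  filter_upwards [ae_integrable_field hn hT hS] with ω hω
  simp only [wignerD_mulVec_coeff hω]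

theorem DeltaAt_mulVec_polyspectrum [SFinite P] (hn : n ≠ 0)
    (hT : Measurable (Function.uncurry T)) (hS : supMoment P T n < ⊤) (l : Fin n → ℕ) (g : SO3) :
    (DeltaAt l g).mulVec (polyspectrum P T l) = rotatedPolyspectrum P T l g := by
  funext m
  simp only [rotatedPolyspectrum, ← DeltaAt_mulVec_kronVec, Matrix.mulVec, dotProduct,
    polyspectrum, ← integral_const_mul]
  rw [integral_finsetSum]
  exact fun k _ => (integrable_kronVec_coeff hn hT hS l k).const_mul _

/-! ### Permutations of the degrees -/

theorem polyspectrum_perm (l : Fin n → ℕ) (σ : Equiv.Perm (Fin n)) (m : KIdx l) :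
    polyspectrum P T (fun i => l (σ i)) (fun i => m (σ i)) = polyspectrum P T l m := by
  simp only [polyspectrum, kronVec]
  congr 1
  funext ω
  exact Equiv.prod_comp σ fun i => coeff T (l i) ω (m i)

theorem Delta_perm (l : Fin n → ℕ) (σ : Equiv.Perm (Fin n)) (m m' : KIdx l) :
    Delta (fun i => l (σ i)) (fun i => m (σ i)) (fun i => m' (σ i)) = Delta l m m' := by
  simp only [Delta, DeltaAt, Matrix.of_apply]
  congr 1
  funext g
  exact Equiv.prod_comp σ fun i => wignerD (l i) g (m i) (m' i)

/-- Entries of `Δ` and of `S` are built from products over the slots, so permuting degrees and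
indices together changes nothing; the degrees may therefore be sorted. -/
theorem Delta_mulVec_polyspectrum_of_monotone
    (h : ∀ l : Fin n → ℕ, Monotone l → (Delta l).mulVec (polyspectrum P T l) = polyspectrum P T l)
    (l : Fin n → ℕ) : (Delta l).mulVec (polyspectrum P T l) = polyspectrum P T l := by
  set σ := Tuple.sort l
  have hmono : Monotone fun i => l (σ i) := Tuple.monotone_sort l
  funext m
  have h1 := congrFun (h _ hmono) fun i => m (σ i)
  rw [polyspectrum_perm l σ] at h1
  rw [← h1]
  simp only [Matrix.mulVec, dotProduct]
  refine Fintype.sum_equiv (Equiv.piCongrLeft (fun i => MIdx (l i)) σ).symm _ _ fun k => ?_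
  have hk : (Equiv.piCongrLeft (fun i => MIdx (l i)) σ).symm k = fun i => k (σ i) := by
    funext i
    simp
  rw [hk, Delta_perm l σ, polyspectrum_perm l σ]

end Moments

/-! ### Completeness of products of spherical harmonics -/

/-- Polynomial functions on the sphere. -/
noncomputable def polyAlg : Subalgebra ℂ (S2 → ℂ) := Algebra.adjoin ℂ (Set.range coordFun)

theorem exists_mem_affineFun_pow {f : S2 → ℂ} (hf : f ∈ polyAlg) : ∃ L, f ∈ affineFun ^ L := by
  induction hf using Algebra.adjoin_induction with
  | mem f hf =>
    obtain ⟨i, rfl⟩ := hf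
    exact ⟨1, by simpa using coordFun_mem_affineFun i⟩
  | algebraMap r => exact ⟨0, by rw [pow_zero]; exact Submodule.algebraMap_mem r⟩
  | add f h _ _ hf hh =>
    obtain ⟨a, ha⟩ := hf
    obtain ⟨b, hb⟩ := hh
    exact ⟨max a b, add_mem (affineFun_pow_mono (le_max_left a b) ha)
      (affineFun_pow_mono (le_max_right a b) hb)⟩
  | mul f h _ _ hf hh =>
    obtain ⟨a, ha⟩ := hf
    obtain ⟨b, hb⟩ := hh
    exact ⟨a + b, by rw [pow_add]; exact Submodule.mul_mem_mul ha hb⟩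

theorem star_mem_polyAlg {f : S2 → ℂ} (hf : f ∈ polyAlg) : star f ∈ polyAlg := by
  induction hf using Algebra.adjoin_induction with
  | mem f hf =>
    obtain ⟨i, rfl⟩ := hf
    have h : star (coordFun i) = coordFun i := by funext x; simp [coordFun]
    rw [h]
    exact Algebra.subset_adjoin ⟨i, rfl⟩
  | algebraMap r =>
    have h : star (algebraMap ℂ (S2 → ℂ) r) = algebraMap ℂ (S2 → ℂ) (conj r) := by
      funext x; simp [Algebra.algebraMap_eq_smul_one]
    rw [h]
    exact Subalgebra.algebraMap_mem _ _
  | add f h _ _ hf hh => rw [star_add]; exact add_mem hf hh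
  | mul f h _ _ hf hh => rw [star_mul]; exact mul_mem hh hf

theorem coordFun_mem_polyAlg (i : Fin 3) : coordFun i ∈ polyAlg :=
  Algebra.subset_adjoin ⟨i, rfl⟩

/-- Elements of `polyAlg` are finite sums of conjugates of spherical harmonics. -/
theorem exists_eq_sum_conj_sphHarm {f : S2 → ℂ} (hf : f ∈ polyAlg) :
    ∃ (s : Finset (Σ l, MIdx l)) (c : (Σ l, MIdx l) → ℂ),
      ∀ x, f x = ∑ k ∈ s, c k * conj (sphHarm k.1 k.2 x) := by
  -- Expanding the conjugate of `f` and conjugating back yields conjugated harmonics.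
  obtain ⟨L, hL⟩ := exists_mem_affineFun_pow (star_mem_polyAlg hf)
  have h := eq_sum_of_mem_harmSpan (affineFun_pow_le_harmSpan L hL)
  refine ⟨(Finset.range (L + 1)).sigma fun l => Finset.univ,
    fun k => conj (sphInner (sphHarm k.1 k.2) (star f)), fun x => ?_⟩
  have hx := congrArg conj (congrFun h x)
  rw [Finset.sum_sigma]
  simpa using hx

section Density

variable {n : ℕ}

/-- The span of the products of polynomial functions of the individual variables. -/
noncomputable def prodSpan (n : ℕ) : Submodule ℂ ((Fin n → S2) → ℂ) :=
  Submodule.span ℂ {h | ∃ f : Fin n → S2 → ℂ, (∀ i, f i ∈ polyAlg) ∧ h = fun x => ∏ i, f i (x i)}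

theorem prod_mem_prodSpan {f : Fin n → S2 → ℂ} (hf : ∀ i, f i ∈ polyAlg) :
    (fun x : Fin n → S2 => ∏ i, f i (x i)) ∈ prodSpan n :=
  Submodule.subset_span ⟨f, hf, rfl⟩

theorem one_mem_prodSpan : (1 : (Fin n → S2) → ℂ) ∈ prodSpan n := by
  have h := prod_mem_prodSpan (n := n) (f := fun _ => 1) fun _ => one_mem _
  convert! h using 1
  funext x
  simp

theorem mul_mem_prodSpan {f h : (Fin n → S2) → ℂ} (hf : f ∈ prodSpan n) (hh : h ∈ prodSpan n) :
    f * h ∈ prodSpan n := by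
  have hle : prodSpan n * prodSpan n ≤ prodSpan n := by
    rw [prodSpan, Submodule.span_mul_span, Submodule.span_le]
    rintro _ ⟨_, ⟨f, hf, rfl⟩, _, ⟨h, hh, rfl⟩, rfl⟩
    refine Submodule.subset_span ⟨fun i => f i * h i, fun i => mul_mem (hf i) (hh i), ?_⟩
    funext x
    simp [Finset.prod_mul_distrib]
  exact hle (Submodule.mul_mem_mul hf hh)

theorem star_mem_prodSpan {f : (Fin n → S2) → ℂ} (hf : f ∈ prodSpan n) : star f ∈ prodSpan n := by
  induction hf using Submodule.span_induction with
  | mem f hf =>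
    obtain ⟨f, hf, rfl⟩ := hf
    refine Submodule.subset_span ⟨fun i => star (f i), fun i => star_mem_polyAlg (hf i), ?_⟩
    funext x
    simp
  | zero => simp
  | add f h _ _ hf hh => rw [star_add]; exact add_mem hf hh
  | smul c f _ hf => rw [star_smul]; exact Submodule.smul_mem _ _ hf

open scoped BoundedContinuousFunction in
/-- The continuous functions in `prodSpan n`. -/
noncomputable def prodAlg (n : ℕ) : StarSubalgebra ℂ ((Fin n → S2) →ᵇ ℂ) where
  carrier := {h | ⇑h ∈ prodSpan n}
  mul_mem' {f h} hf hh := by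
    change ⇑(f * h) ∈ prodSpan n
    rw [BoundedContinuousFunction.coe_mul]
    exact mul_mem_prodSpan hf hh
  add_mem' {f h} hf hh := by
    change ⇑(f + h) ∈ prodSpan n
    rw [BoundedContinuousFunction.coe_add]
    exact add_mem hf hh
  algebraMap_mem' r := by
    have h : ⇑(algebraMap ℂ ((Fin n → S2) →ᵇ ℂ) r) = r • (1 : (Fin n → S2) → ℂ) := by
      funext x
      simp
    change ⇑(algebraMap ℂ ((Fin n → S2) →ᵇ ℂ) r) ∈ prodSpan n
    rw [h]
    exact Submodule.smul_mem _ _ one_mem_prodSpan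
  star_mem' {f} hf := by
    change ⇑(star f) ∈ prodSpan n
    rw [BoundedContinuousFunction.coe_star]
    exact star_mem_prodSpan hf

theorem prodAlg_separatesPoints (n : ℕ) :
    ((prodAlg n).map (BoundedContinuousFunction.toContinuousMapStarₐ ℂ)).SeparatesPoints := by
  intro x y hxy
  obtain ⟨i, hi⟩ := Function.ne_iff.1 hxy
  obtain ⟨j, hj⟩ : ∃ j, (x i).1 j ≠ (y i).1 j := by
    by_contra! h
    exact hi (S2.ext_coord h)
  have hc : Continuous fun x : Fin n → S2 => coordFun j (x i) :=
    Complex.continuous_ofReal.comp ((continuous_coord j).comp (continuous_apply i))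
  refine ⟨fun x => coordFun j (x i), ⟨⟨_, hc⟩,
    ⟨BoundedContinuousFunction.mkOfCompact ⟨_, hc⟩, ?_, rfl⟩, rfl⟩, ?_⟩
  · change (fun x : Fin n → S2 => coordFun j (x i)) ∈ prodSpan n
    refine Submodule.subset_span ⟨fun k => if k = i then coordFun j else 1, fun k => ?_, ?_⟩
    · dsimp only
      split_ifs
      · exact coordFun_mem_polyAlg j
      · exact one_mem _
    · funext x
      rw [Finset.prod_eq_single i]
      · simp
      · intro k _ hk
        simp [hk]
      · simp
  · simpa [coordFun] using hj

/-- Integrability is carried through the induction because additivity of the integral needs it. -/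
theorem integral_mul_eq_zero_of_mem_prodSpan {f : (Fin n → S2) → ℝ}
    (hf : Integrable f (surfPi n))
    (h : ∀ (l : Fin n → ℕ) (m : KIdx l), ∫ x, (f x : ℂ) * conjHarmProd l m x ∂surfPi n = 0)
    {u : (Fin n → S2) → ℂ} (hu : u ∈ prodSpan n) :
    Integrable (fun x => (f x : ℂ) * u x) (surfPi n) ∧ ∫ x, (f x : ℂ) * u x ∂surfPi n = 0 := by
  have hi : ∀ (l : Fin n → ℕ) (m : KIdx l),
      Integrable (fun x => (f x : ℂ) * conjHarmProd l m x) (surfPi n) := fun l m => by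
    obtain ⟨C, hC⟩ := exists_norm_conjHarmProd_le l m
    exact hf.ofReal.mul_bdd (c := C) (continuous_conjHarmProd l m).aestronglyMeasurable
      (Filter.Eventually.of_forall hC)
  induction hu using Submodule.span_induction with
  | mem u hu =>
    obtain ⟨v, hv, rfl⟩ := hu
    choose s c hsc using fun i => exists_eq_sum_conj_sphHarm (hv i)
    have hexp : (fun x : Fin n → S2 => (f x : ℂ) * ∏ i, v i (x i)) = fun x =>
        ∑ p ∈ Fintype.piFinset s, (∏ i, c i (p i)) *
          ((f x : ℂ) * conjHarmProd (fun i => (p i).1) (fun i => (p i).2) x) := by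
      funext x
      simp only [hsc, Finset.prod_univ_sum, Finset.mul_sum, conjHarmProd, Finset.prod_mul_distrib]
      exact Finset.sum_congr rfl fun p _ => by ring
    rw [hexp]
    refine ⟨integrable_finsetSum _ fun p _ => (hi _ _).const_mul _, ?_⟩
    rw [integral_finsetSum _ fun p _ => (hi _ _).const_mul _]
    refine Finset.sum_eq_zero fun p _ => ?_
    rw [integral_const_mul, h, mul_zero]
  | zero => simp
  | add u v _ _ hu hv =>
    simp only [Pi.add_apply, mul_add]
    exact ⟨hu.1.add hv.1, by rw [integral_add hu.1 hv.1, hu.2, hv.2, add_zero]⟩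
  | smul a u _ hu =>
    have h1 : (fun x => (f x : ℂ) * (a • u) x) = fun x => a * ((f x : ℂ) * u x) := by
      funext x
      simp only [Pi.smul_apply, smul_eq_mul]
      ring
    rw [h1]
    exact ⟨hu.1.const_mul a, by rw [integral_const_mul, hu.2, mul_zero]⟩

/-- `f` is merely integrable, so Hilbert space completeness does not apply. Instead, the finite
measures with densities `f⁺` and `f⁻` agree on a star algebra of continuous functions separating
points, hence coincide. Thus `f⁺ = f⁻` almost everywhere, and one of the two always vanishes. -/
theorem ae_eq_zero_of_forall_integral_conjHarmProd {f : (Fin n → S2) → ℝ}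
    (hf : Integrable f (surfPi n))
    (h : ∀ (l : Fin n → ℕ) (m : KIdx l), ∫ x, (f x : ℂ) * conjHarmProd l m x ∂surfPi n = 0) :
    ∀ᵐ x ∂surfPi n, f x = 0 := by
  have hm : AEMeasurable (fun x => ENNReal.ofReal (f x)) (surfPi n) :=
    hf.aemeasurable.ennreal_ofReal
  have hm' : AEMeasurable (fun x => ENNReal.ofReal (-f x)) (surfPi n) :=
    hf.aemeasurable.neg.ennreal_ofReal
  have : IsFiniteMeasure ((surfPi n).withDensity fun x => ENNReal.ofReal (f x)) :=
    isFiniteMeasure_withDensity_ofReal hf.2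
  have : IsFiniteMeasure ((surfPi n).withDensity fun x => ENNReal.ofReal (-f x)) :=
    isFiniteMeasure_withDensity_ofReal hf.neg.2
  have heq : ((surfPi n).withDensity fun x => ENNReal.ofReal (f x)) =
      (surfPi n).withDensity fun x => ENNReal.ofReal (-f x) := by
    refine ext_of_forall_mem_subalgebra_integral_eq_of_polish (prodAlg_separatesPoints n) ?_
    intro u hu
    rw [integral_withDensity_eq_integral_toReal_smul₀ hm (by simp),
      integral_withDensity_eq_integral_toReal_smul₀ hm' (by simp), ← sub_eq_zero,
      ← integral_sub, ← (integral_mul_eq_zero_of_mem_prodSpan hf h hu).2]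
    · congr 1
      funext x
      rw [← sub_smul, ENNReal.toReal_ofReal', ENNReal.toReal_ofReal', max_zero_sub_eq_self,
        Complex.real_smul]
    all_goals
      simp only [ENNReal.toReal_ofReal', Complex.real_smul]
      refine Integrable.mul_bdd (c := ‖u‖) ?_ u.continuous.aestronglyMeasurable
        (Filter.Eventually.of_forall u.norm_coe_le_norm)
    · exact hf.pos_part.ofReal
    · exact hf.neg_part.ofReal
  have hae := (withDensity_eq_iff_of_sigmaFinite hm hm').1 heq
  filter_upwards [hae] with x hx
  rcases le_total 0 (f x) with h0 | h0
  · rw [ENNReal.ofReal_of_nonpos (neg_nonpos.2 h0), ENNReal.ofReal_eq_zero] at hx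
    exact le_antisymm hx h0
  · rw [ENNReal.ofReal_of_nonpos h0, eq_comm, ENNReal.ofReal_eq_zero] at hx
    linarith

end Density

/-! ### Separate continuity -/

/-- By Fubini and induction, for almost every first variable the slice vanishes identically.
Continuity in the first variable alone, and positivity of the measure on open sets, then remove the
exceptional null set. -/
theorem eq_zero_of_ae_of_separately_continuous {X : Type*} [TopologicalSpace X]
    [MeasurableSpace X] (μ : Measure X) [SigmaFinite μ] [μ.IsOpenPosMeasure] {n : ℕ}
    (G : (Fin n → X) → ℝ) (hG : ∀ x j, Continuous fun y => G (Function.update x j y))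
    (h : ∀ᵐ x ∂Measure.pi fun _ : Fin n => μ, G x = 0) (x : Fin n → X) : G x = 0 := by
  induction n with
  | zero =>
    rw [Measure.pi_of_empty _ x, ae_dirac_eq] at h
    simpa using h
  | succ n ih =>
    have hmp := (measurePreserving_piFinSuccAbove (fun _ : Fin (n + 1) => μ) 0).symm
    have h1 := hmp.quasiMeasurePreserving.ae h
    have h2 := Measure.ae_ae_of_ae_prod h1
    have h3 : ∀ᵐ a ∂μ, ∀ y : Fin n → X, G (Fin.cons a y) = 0 := by
      filter_upwards [h2] with a ha
      refine ih (fun y => G (Fin.cons a y)) ?_ ?_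
      · intro y j
        simpa [Fin.cons_update] using hG (Fin.cons a y) j.succ
      · simpa [MeasurableEquiv.piFinSuccAbove, Fin.consEquiv] using ha
    have h4 : (fun a => G (Fin.cons a (Fin.tail x))) = fun _ => 0 := by
      have hc : Continuous fun a => G (Fin.cons a (Fin.tail x)) := by
        simpa only [Fin.update_cons_zero] using hG (Fin.cons (x 0) (Fin.tail x)) 0
      refine (hc.ae_eq_iff_eq μ continuous_const).1 ?_
      filter_upwards [h3] with a ha
      exact ha _
    have h5 := congrFun h4 (x 0)
    simpa using h5

/-! ### Continuity of the `n`-point moment in each variable. -/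

section Continuity

variable {Ω : Type*} [MeasurableSpace Ω] {P : Measure Ω} {T : S2 → Ω → ℝ} {n : ℕ}

theorem eLpNorm_le_supMoment (hn : n ≠ 0) (x : S2) :
    eLpNorm (T x) n P ≤ supMoment P T n ^ (1 / (n : ℝ)) := by
  rw [eLpNorm_eq_lintegral_rpow_enorm_toReal (by exact_mod_cast hn) (by simp)]
  simp only [ENNReal.toReal_natCast, ENNReal.rpow_natCast]
  exact ENNReal.rpow_le_rpow (lintegral_pow_le_supMoment x) (by positivity)

/-- A uniform `Lⁿ` bound and convergence in probability do not give `Lⁿ` convergence of `T`. Against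
a fixed `Z` in `L^q` with `q` finite, Hölder gives uniform integrability of the products, and
Vitali's theorem applies. Hence the treatment of one variable at a time. -/
theorem continuous_integral_mul [IsProbabilityMeasure P] (hn : n ≠ 0)
    (hT : Measurable (Function.uncurry T))
    (hS : supMoment P T n < ⊤) (hc : StochContinuous P T) {q : ENNReal}
    [hq : ENNReal.HolderTriple n q 1] (hq1 : 1 ≤ q) (hq2 : q ≠ ⊤) {Z : Ω → ℝ}
    (hZ : MemLp Z q P) : Continuous fun x => ∫ ω, T x ω * Z ω ∂P := by
  rw [continuous_iff_seqContinuous]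
  intro y x hyx
  have hint : ∀ x, MemLp (fun ω => T x ω * Z ω) 1 P := fun x =>
    hZ.mul' (memLp_of_supMoment hn hT hS x)
  set M := supMoment P T n ^ (1 / (n : ℝ)) with hM
  have hMtop : M ≠ ⊤ := ENNReal.rpow_ne_top_of_nonneg (by positivity) hS.ne
  have hui : UnifIntegrable (fun k ω => T (y k) ω * Z ω) 1 P := by
    intro ε hε
    -- The `+ 1` covers the case `M = 0`.
    obtain ⟨δ, hδ, hδ'⟩ := hZ.eLpNorm_indicator_le hq1 hq2
      (ε := ε / (M.toReal + 1)) (by positivity)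
    refine ⟨δ, hδ, fun k s hs hμs => ?_⟩
    have h1 : s.indicator (fun ω => T (y k) ω * Z ω) = T (y k) • s.indicator Z := by
      funext ω
      simp only [Pi.smul_apply', smul_eq_mul, Set.indicator]
      split_ifs <;> simp
    rw [h1]
    calc eLpNorm (T (y k) • s.indicator Z) 1 P
        ≤ eLpNorm (T (y k)) n P * eLpNorm (s.indicator Z) q P :=
          eLpNorm_smul_le_mul_eLpNorm (hZ.1.indicator hs)
            (measurable_section hT _).aestronglyMeasurable
      _ ≤ M * ENNReal.ofReal (ε / (M.toReal + 1)) :=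
          mul_le_mul' (eLpNorm_le_supMoment hn _) (hδ' s hs hμs)
      _ = ENNReal.ofReal (M.toReal * (ε / (M.toReal + 1))) := by
          rw [ENNReal.ofReal_mul (by positivity), ENNReal.ofReal_toReal hMtop]
      _ ≤ ENNReal.ofReal ε := by
          apply ENNReal.ofReal_le_ofReal
          rw [← mul_div_assoc, div_le_iff₀ (by positivity)]
          nlinarith [ENNReal.toReal_nonneg (a := M)]
  -- Convergence in probability gives almost sure convergence only along a further subsequence,
  -- which suffices.
  refine Filter.tendsto_of_subseq_tendsto fun ns hns => ?_
  have hmeas : TendstoInMeasure P (fun k => T (y (ns k))) Filter.atTop (T x) := fun ε hε =>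
    (hc x ε hε).comp (hyx.comp hns)
  obtain ⟨ms, -, hms'⟩ := hmeas.exists_seq_tendsto_ae
  refine ⟨ms, ?_⟩
  have hL := tendsto_Lp_finite_of_tendsto_ae (μ := P) le_rfl ENNReal.one_ne_top
    (f := fun k ω => T (y (ns (ms k))) ω * Z ω) (g := fun ω => T x ω * Z ω)
    (fun k => (hint _).1) (hint x)
    (fun ε hε => let ⟨δ, hδ, hδ'⟩ := hui hε; ⟨δ, hδ, fun k s hs hμs => hδ' _ s hs hμs⟩) (by
      filter_upwards [hms'] with ω hω
      exact hω.mul_const _)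
  exact tendsto_integral_of_L1' _ (hint x).1
    (Filter.Eventually.of_forall fun k => memLp_one_iff_integrable.1 (hint _)) hL

theorem continuous_pointMoment_update [IsProbabilityMeasure P] (hn : 2 ≤ n)
    (hT : Measurable (Function.uncurry T))
    (hS : supMoment P T n < ⊤) (hc : StochContinuous P T) (x : Fin n → S2) (j : Fin n) :
    Continuous fun y => pointMoment P T (Function.update x j y) := by
  have hn0 : n ≠ 0 := by omega
  have hZ := MemLp.prod' (μ := P) (s := Finset.univ.erase j) (f := fun i => T (x i))
    (p := fun _ => (n : ENNReal)) fun i _ => memLp_of_supMoment hn0 hT hS (x i)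
  have hcard : (n : ENNReal)⁻¹ + ∑ i ∈ Finset.univ.erase j, (n : ENNReal)⁻¹ = 1 := by
    rw [Finset.add_sum_erase _ (fun _ => (n : ENNReal)⁻¹) (Finset.mem_univ j)]
    simp only [Finset.sum_const, Finset.card_univ, Fintype.card_fin, nsmul_eq_mul]
    exact ENNReal.mul_inv_cancel (by exact_mod_cast hn0) (by simp)
  -- The exponent is `n / (n - 1)`, conjugate to `n` and finite because `n ≥ 2`.
  have hq : ENNReal.HolderTriple n (∑ i ∈ Finset.univ.erase j, (n : ENNReal)⁻¹)⁻¹ 1 :=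
    ⟨by rw [inv_inv, hcard, inv_one]⟩
  have hq1 : 1 ≤ (∑ i ∈ Finset.univ.erase j, (n : ENNReal)⁻¹)⁻¹ := by
    rw [ENNReal.one_le_inv, ← hcard]
    exact le_add_self
  have hq2 : (∑ i ∈ Finset.univ.erase j, (n : ENNReal)⁻¹)⁻¹ ≠ ⊤ := by
    rw [Ne, ENNReal.inv_eq_top]
    simp only [Finset.sum_const, Finset.card_erase_of_mem (Finset.mem_univ j), Finset.card_univ,
      Fintype.card_fin, nsmul_eq_mul, mul_eq_zero, not_or]
    exact ⟨by exact_mod_cast (by omega : n - 1 ≠ 0), by simp⟩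
  have h := continuous_integral_mul hn0 hT hS hc hq1 hq2 hZ
  convert! h using 1
  funext y
  rw [pointMoment]
  congr 1
  funext ω
  rw [← Finset.mul_prod_erase _ _ (Finset.mem_univ j)]
  congr 1
  · simp
  · refine Finset.prod_congr rfl fun i hi => ?_
    rw [Function.update_of_ne (Finset.ne_of_mem_erase hi)]

end Continuity

/-! ### Isotropy -/

section Isotropy

variable {Ω : Type*} [MeasurableSpace Ω] {P : Measure Ω} {T : S2 → Ω → ℝ} {n : ℕ}

/-- Rotations act transitively, so every `T(x)` has the law of `T` at the north pole. -/
theorem StronglyIsotropic.supMoment_lt_top (hI : StronglyIsotropic P T) (hn : n ≠ 0)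
    (hL : ∀ x, MemLp (T x) n P) : supMoment P T n < ⊤ := by
  have h1 := (hL northPole).2
  rw [eLpNorm_lt_top_iff_lintegral_rpow_enorm_lt_top (by exact_mod_cast hn) (by simp)] at h1
  simp only [ENNReal.toReal_natCast, ENNReal.rpow_natCast] at h1
  refine lt_of_le_of_lt (iSup_le fun x => ?_) h1
  obtain ⟨g, hg⟩ := exists_rotate_eq_northPole x
  have h2 := (hI 1 (fun _ => x) g).comp
    (u := fun v : Fin 1 → ℝ => ‖v 0‖ₑ ^ n) ((measurable_pi_apply 0).enorm.pow_const n)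
  rw [hg] at h2
  exact h2.lintegral_eq.le

theorem StronglyIsotropic.pointMoment_rotate (hI : StronglyIsotropic P T) (g : SO3)
    (x : Fin n → S2) : pointMoment P (fun x => T (rotate g x)) x = pointMoment P T x := by
  have h := (hI n x g).comp (u := fun v : Fin n → ℝ => ∏ i, v i) (by fun_prop)
  exact h.integral_eq.symm

theorem StronglyIsotropic.DeltaAt_mulVec_polyspectrum [IsProbabilityMeasure P]
    (hI : StronglyIsotropic P T) (hn : 2 ≤ n) (hT : Measurable (Function.uncurry T))
    (hS : supMoment P T n < ⊤) (l : Fin n → ℕ) (g : SO3) :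
    (DeltaAt l g).mulVec (polyspectrum P T l) = polyspectrum P T l := by
  have hn0 : n ≠ 0 := by omega
  rw [Polyspectra.DeltaAt_mulVec_polyspectrum hn0 hT hS,
    rotatedPolyspectrum_eq_polyspectrum hn hT hS]
  funext m
  rw [polyspectrum_eq hn0 (measurable_rotated hT _) ((supMoment_rotated_le _).trans_lt hS),
    polyspectrum_eq hn0 hT hS]
  simp only [hI.pointMoment_rotate]

theorem ae_pointMoment_rotate [IsProbabilityMeasure P] (hn : 2 ≤ n)
    (hT : Measurable (Function.uncurry T)) (hS : supMoment P T n < ⊤)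
    (h : ∀ (l : Fin n → ℕ) (g : SO3), rotatedPolyspectrum P T l g = polyspectrum P T l) (g : SO3) :
    ∀ᵐ x ∂surfPi n, pointMoment P T x = pointMoment P (fun x => T (rotate g x)) x := by
  have hn0 : n ≠ 0 := by omega
  have hT' := measurable_rotated hT g
  have hS' := (supMoment_rotated_le (P := P) (T := T) (n := n) g).trans_lt hS
  have hi := integrable_pointMoment hn0 hT hS
  have hi' := integrable_pointMoment hn0 hT' hS'
  have hz := ae_eq_zero_of_forall_integral_conjHarmProd (hi.sub hi') fun l m => by
    obtain ⟨C, hC⟩ := exists_norm_conjHarmProd_le l m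
    have hb : ∀ {f : (Fin n → S2) → ℝ}, Integrable f (surfPi n) →
        Integrable (fun x => (f x : ℂ) * conjHarmProd l m x) (surfPi n) := fun hf =>
      hf.ofReal.mul_bdd (c := C) (continuous_conjHarmProd l m).aestronglyMeasurable
        (Filter.Eventually.of_forall hC)
    simp only [Pi.sub_apply, Complex.ofReal_sub, sub_mul]
    -- The hypothesis is used at `g⁻¹`, since `D(g⁻¹)` corresponds to the field `T(g ·)`.
    rw [integral_sub (hb hi) (hb hi'), ← polyspectrum_eq hn0 hT hS, ← polyspectrum_eq hn0 hT' hS',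
      ← h l g⁻¹, rotatedPolyspectrum_eq_polyspectrum hn hT hS, inv_inv, sub_self]
  filter_upwards [hz] with x hx
  exact sub_eq_zero.1 hx

theorem StochContinuous.rotated (hc : StochContinuous P T) (g : SO3) :
    StochContinuous P fun x => T (rotate g x) := fun x ε hε =>
  (hc (rotate g x) ε hε).comp (continuous_rotate g).continuousAt

theorem weaklyIsotropic_of_stochContinuous [IsProbabilityMeasure P] (hn : 2 ≤ n)
    (hT : Measurable (Function.uncurry T)) (hS : supMoment P T n < ⊤)
    (h : ∀ g : SO3, ∀ᵐ x ∂surfPi n,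
      pointMoment P T x = pointMoment P (fun x => T (rotate g x)) x)
    (hc : StochContinuous P T) : WeaklyIsotropic P T n := by
  refine ⟨memLp_of_supMoment (by omega) hT hS, fun x g => ?_⟩
  refine sub_eq_zero.1 (eq_zero_of_ae_of_separately_continuous surf
    (fun x => pointMoment P T x - pointMoment P (fun x => T (rotate g x)) x) ?_ ?_ x)
  · intro x j
    exact (continuous_pointMoment_update hn hT hS hc x j).sub
      (continuous_pointMoment_update hn (measurable_rotated hT g)
        ((supMoment_rotated_le g).trans_lt hS) (hc.rotated g) x j)
  · filter_upwards [h g] with x hx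
    exact sub_eq_zero.2 hx

end Isotropy

end Polyspectra

/-! ### The main theorem. -/

theorem mainTheorem3 {Ω : Type*} [MeasurableSpace Ω] (P : MeasureTheory.Measure Ω)
    [MeasureTheory.IsProbabilityMeasure P] (T : Polyspectra.S2 → Ω → ℝ)
    (hT : Polyspectra.IsRandomField P T) (n : ℕ) (hn : 2 ≤ n) :
    (Polyspectra.StronglyIsotropic P T → (∀ x, MeasureTheory.MemLp (T x) n P) →
      Polyspectra.FiniteSpectralMoments P T n ∧
      ∀ l : Fin n → ℕ,
        (Polyspectra.Delta l).mulVec (Polyspectra.polyspectrum P T l) =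
          Polyspectra.polyspectrum P T l ∧
        ∀ g : Polyspectra.SO3,
          (Polyspectra.DeltaAt l g).mulVec (Polyspectra.polyspectrum P T l) =
            Polyspectra.polyspectrum P T l) ∧
    (Polyspectra.supMoment P T n < ⊤ →
      (∀ᵐ ω ∂P, MeasureTheory.MemLp (fun x => T x ω) 2 Polyspectra.surf) ∧
      Polyspectra.FiniteSpectralMoments P T n ∧
      ((∀ l : Fin n → ℕ, Monotone l →
          (Polyspectra.Delta l).mulVec (Polyspectra.polyspectrum P T l) =
            Polyspectra.polyspectrum P T l) →
        (∀ (l : Fin n → ℕ) (g : Polyspectra.SO3),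
          Polyspectra.rotatedPolyspectrum P T l g = Polyspectra.polyspectrum P T l) ∧
        (∀ g : Polyspectra.SO3,
          ∀ᵐ x ∂(MeasureTheory.Measure.pi fun _ : Fin n => Polyspectra.surf),
            ∫ ω, ∏ i, T (x i) ω ∂P = ∫ ω, ∏ i, T (Polyspectra.rotate g (x i)) ω ∂P) ∧
        (Polyspectra.StochContinuous P T → Polyspectra.WeaklyIsotropic P T n))) := by
  have hn0 : n ≠ 0 := by omega
  refine ⟨fun hI hL => ?_, fun hS => ?_⟩
  · have hS := hI.supMoment_lt_top hn0 hL
    refine ⟨Polyspectra.finiteSpectralMoments_of_supMoment hn0 hT.measurable hS, fun l => ?_⟩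
    have h := hI.DeltaAt_mulVec_polyspectrum hn hT.measurable hS l
    exact ⟨Polyspectra.Delta_mulVec_of_forall l _ h, h⟩
  · refine ⟨Polyspectra.ae_memLp_two hn hT.measurable hS,
      Polyspectra.finiteSpectralMoments_of_supMoment hn0 hT.measurable hS, fun hD => ?_⟩
    have hrot : ∀ (l : Fin n → ℕ) (g : Polyspectra.SO3),
        Polyspectra.rotatedPolyspectrum P T l g = Polyspectra.polyspectrum P T l := fun l g => by
      rw [← Polyspectra.DeltaAt_mulVec_polyspectrum hn0 hT.measurable hS]
      exact Polyspectra.DeltaAt_mulVec_of_Delta l _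
        (Polyspectra.Delta_mulVec_polyspectrum_of_monotone hD l) g
    have hae := Polyspectra.ae_pointMoment_rotate hn hT.measurable hS hrot
    exact ⟨hrot, hae, Polyspectra.weaklyIsotropic_of_stochContinuous hn hT.measurable hS hae⟩
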